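/- **Setting.** Let $m\ge 1$, let $\mathcal W\subseteq\mathbb R^d$ be closed and convex, let $f,g_1,\dots,g_m:\mathcal W\to\mathbb R$ be convex, and put $g(w)=\max_i g_i(w)$. Let $D\ge 1$ satisfy $\|w-w'\|_2\le D$ for all $w,w'\in\mathcal W$. Suppose that $f$ is $L_f$-Lipschitz, that each $g_i$ is $L_g$-Lipschitz (Euclidean norm), and that for some $\rho>0$ we have $\|v\|_2\ge\rho$ whenever $g(w)=0$ and $v\in\partial g(w)$. Here $\partial\varphi(w)=\{v:\varphi(w')\ge\varphi(w)+\langle v,w'-w\rangle\ \forall w'\in\mathcal W\}$. Let $\gamma>L_f/\rho$ and $h(w)=f(w)+\gamma\max\{0,g(w)\}$. $\Pi_w$ and $\Pi_g$ denote the Euclidean projections onto $\mathcal W$ and onto $\{w\in\mathcal W:g(w)\le 0\}$. Let $\check\nabla\max\{0,g_i(w)\}\in\partial\max\{0,g_i\}(w)$ be a (measurable) choice of subgradients with $\|\check\nabla\max\{0,g_i(w)\}\|_2\le G_g$ for all $i$ and $w\in\mathcal W$. A stochastic subgradient of $f$ at iteration $t$ is a random vector $\check\Delta^{(t)}$ with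 $\|\check\Delta^{(t)}\|_2\le G_f$ almost surely whose conditional expectation given the past lies in $\partial f(w^{(t)})$. Assume $G_f,G_g\ge0$, $G_f+\gamma G_g>0$, and write $A=G_f+\gamma G_g+\gamma L_gD$. A *constraint check* is one evaluation or one differentiation of a single $g_i$. **FullTouch** ($T$, $\eta$). Start at an arbitrary $w^{(1)}\in\mathcal W$. For $t=1,\dots,T$: sample $\check\Delta^{(t)}$; evaluate all $g_j(w^{(t)})$, let $i$ be the index of a largest one, and set $w^{(t+1)}=\Pi_w\big(w^{(t)}-\eta(\check\Delta^{(t)}+\gamma\check\nabla\max\{0,g_i(w^{(t)})\})\big)$. **LightTouch** ($T$, $\eta$, $k\le m$). Start at an arbitrary $w^{(1)}\in\mathcal W$, with $p^{(1)}$ uniform on $\{1,\dots,m\}$ and $\mu^{(1)}_j=\max\{0,g_j(w^{(1)})\}$. For $t=1,\dots,T$: sample $\check\Delta^{(t)}$, an index $i^{(t)}$ which given the past has law $p^{(t)}$, and a set $S^{(t)}$ which given the past is uniform among the $k$-element subsets of $\{1,\dots,m\}$. Set $$w^{(t+1)}=\Pi_w\big(w^{(t)}-\eta(\check\Delta^{(t)}+\gamma\check\nabla\max\{0,g_{i^{(t)}}(w^{(t)})\})\big),$$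 $$\hat\Delta_p^{(t)}=\gamma\mu^{(t)}+\tfrac{\gamma m}{k}\sum_{j\in S^{(t)}}e_j\big(\max\{0,g_j(w^{(t)})\}-\mu_j^{(t)}\big),$$ $\tilde p^{(t+1)}=\exp(\ln p^{(t)}+\eta\hat\Delta_p^{(t)})$ elementwise, $p^{(t+1)}=\tilde p^{(t+1)}/\|\tilde p^{(t+1)}\|_1$, and $\mu^{(t+1)}_j=\max\{0,g_j(w^{(t)})\}$ for $j\in S^{(t)}$, $\mu^{(t+1)}_j=\mu^{(t)}_j$ otherwise. In both cases the output is $\bar w=\frac1T\sum_{t=1}^Tw^{(t)}$. **Theorem.** There are universal constants $c,K>0$ such that the following holds for all data as above and all $\epsilon>0$, $0<\delta<1$. Let $$T_\epsilon=\left\lceil c\,\frac{(1+\ln m)D^2A^2(1+\ln\frac1\delta)}{\epsilon^2}\right\rceil,\qquad k=\left\lceil\frac{m(1+\ln m)^{3/4}\sqrt{1+\ln\frac1\delta}\sqrt{1+\ln T_\epsilon}}{T_\epsilon^{1/4}}\right\rceil .$$ If $k\le m$, run $T_\epsilon$ iterations of LightTouch with minibatch size $k$ and $\eta=\frac{\sqrt{1+\ln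 m}\,D}{A\sqrt{T_\epsilon}}$. If $k>m$, run $T_\epsilon$ iterations of FullTouch with $\eta=\frac{D}{(G_f+\gamma G_g)\sqrt{T_\epsilon}}$. In either case, for every $w^*\in\mathcal W$ with $g_i(w^*)\le0$ for all $i$, with probability at least $1-\delta$: $$f(\Pi_g(\bar w))-f(w^*)\le h(\bar w)-h(w^*)\le\epsilon\quad\text{and}\quad\|\bar w-\Pi_g(\bar w)\|_2\le\frac{\epsilon}{\gamma\rho-L_f}.$$ Moreover, if $\epsilon\le DA$, the total number of constraint checks (including those of the initialization of $\mu$) is at most $$K\left(\frac{(1+\ln m)D^2A^2(1+\ln\frac1\delta)}{\epsilon^2}+\frac{m(1+\ln m)^{3/2}D^{3/2}A^{3/2}(1+\ln\frac1\delta)^{5/4}}{\epsilon^{3/2}}\sqrt{1+\ln T_\epsilon}\right).$$ -/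

import Mathlib

open MeasureTheory ProbabilityTheory
open scoped BigOperators NNReal ENNReal

noncomputable section

namespace LightTouch

/-- The ambient Euclidean space `ℝ^d`. -/
abbrev E (d : ℕ) : Type := EuclideanSpace ℝ (Fin d)

/-! ### The constrained problem -/

/-- The subdifferential at `w` of a function `φ : W → ℝ`: all `v` such that
`φ w' ≥ φ w + ⟨v, w' - w⟩` for every `w'` in the domain `W`. -/
def subdifferential {d : ℕ} (W : Set (E d)) (φ : E d → ℝ) (w : E d) : Set (E d) :=
  {v | ∀ w' ∈ W, φ w + inner ℝ v (w' - w) ≤ φ w'}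

/-- The combined constraint `g(w) = max_i g_i(w)`. -/
def maxConstraint {d m : ℕ} [NeZero m] (g : Fin m → E d → ℝ) (w : E d) : ℝ :=
  Finset.univ.sup' Finset.univ_nonempty (fun i => g i w)

/-- The feasible set `{w ∈ W : g_i(w) ≤ 0 for all i}`. -/
def feasible {d m : ℕ} (W : Set (E d)) (g : Fin m → E d → ℝ) : Set (E d) :=
  {w | w ∈ W ∧ ∀ i, g i w ≤ 0}

/-- The penalized objective `h(w) = f(w) + γ max(0, g(w))`. -/
def penalized {d m : ℕ} [NeZero m] (f : E d → ℝ) (g : Fin m → E d → ℝ) (γ : ℝ) (w : E d) : ℝ :=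
  f w + γ * max 0 (maxConstraint g w)

/-- Euclidean projection onto a set: a point of `K` nearest to `x`. (For nonempty closed convex
`K`, the only case that is used, it exists and is unique.) -/
def proj {d : ℕ} (K : Set (E d)) (x : E d) : E d :=
  Classical.epsilon fun y => y ∈ K ∧ ∀ z ∈ K, ‖x - y‖ ≤ ‖x - z‖

/-! ### Computations that count constraint checks -/

/-- The result of a computation together with the number of constraint checks (evaluations or
differentiations of a single `g_i`) that it has performed. -/
structure Counted (α : Type) where
  val : α
  checks : ℕ

instance : Monad Counted where
  pure a := ⟨a, 0⟩
  bind x k := ⟨(k x.val).val, x.checks + (k x.val).checks⟩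

/-- Evaluation of a single constraint: one check. -/
def checkValue {d m : ℕ} (g : Fin m → E d → ℝ) (i : Fin m) (w : E d) : Counted ℝ := ⟨g i w, 1⟩

/-- Differentiation of a single constraint, i.e. one call of the oracle `dg` that returns
a subgradient of `max(0, g_i)` at `w`: one check. -/
def checkGrad {d m : ℕ} (dg : Fin m → E d → E d) (i : Fin m) (w : E d) : Counted (E d) :=
  ⟨dg i w, 1⟩

/-- Perform the computation `F j` once for every `j ∈ S` and record the results in a vector, with
`0` at the places outside `S`. -/
def forEach {m : ℕ} (S : Finset (Fin m)) (F : Fin m → Counted ℝ) : Counted (Fin m → ℝ) :=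
  ⟨fun j => if j ∈ S then (F j).val else 0, ∑ j ∈ S, (F j).checks⟩

/-! ### FullTouch -/

/-- One iteration of FullTouch, given the sampled stochastic subgradient `ξ` of `f` at `w`.
`sel` is the rule that picks the index of a largest entry of a vector: the subgradient of
`max(0, g)` is that of `max(0, g_i)` for a most violated constraint `i`. -/
def fullStep {d m : ℕ} (W : Set (E d)) (g : Fin m → E d → ℝ) (dg : Fin m → E d → E d)
    (sel : (Fin m → ℝ) → Fin m) (γ η : ℝ) (w ξ : E d) : Counted (E d) := do
  let v ← forEach Finset.univ (fun j => checkValue g j w)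
  let u ← checkGrad dg (sel v) w
  pure (proj W (w - η • (ξ + γ • u)))

/-- The iterate of FullTouch after `t` iterations (so `0` is the initial point `w^{(1)}`). -/
def fullIter {d m : ℕ} (W : Set (E d)) (g : Fin m → E d → ℝ) (dg : Fin m → E d → E d)
    (sel : (Fin m → ℝ) → Fin m) (γ η : ℝ) (w₁ : E d) (ξ : ℕ → E d) : ℕ → Counted (E d)
  | 0 => pure w₁
  | t + 1 => do
    let w ← fullIter W g dg sel γ η w₁ ξ t
    fullStep W g dg sel γ η w (ξ t)

/-- `T` iterations of FullTouch, returning the average iterate `w̄ = (∑_{t=1}^T w^{(t)}) / T`. -/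
def fullTouch {d m : ℕ} (W : Set (E d)) (g : Fin m → E d → ℝ) (dg : Fin m → E d → E d)
    (sel : (Fin m → ℝ) → Fin m) (γ η : ℝ) (T : ℕ) (w₁ : E d) (ξ : ℕ → E d) : Counted (E d) where
  val := (T : ℝ)⁻¹ • ∑ t ∈ Finset.range T, (fullIter W g dg sel γ η w₁ ξ t).val
  checks := (fullIter W g dg sel γ η w₁ ξ T).checks

/-! ### LightTouch -/

/-- The variables that LightTouch maintains: the iterate `w`, the distribution `p` over the
constraints, and the remembered values `μ` of the `max(0, g_j)`. -/
structure State (d m : ℕ) where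
  w : E d
  p : Fin m → ℝ
  μ : Fin m → ℝ

/-- Initialization: `p` uniform, `μ_j = max(0, g_j(w₁))`. -/
def lightInit {d m : ℕ} (g : Fin m → E d → ℝ) (w₁ : E d) : Counted (State d m) := do
  let v ← forEach Finset.univ (fun j => checkValue g j w₁)
  pure { w := w₁, p := fun _ => 1 / (m : ℝ), μ := fun j => max 0 (v j) }

/-- The stochastic supergradient `γ μ + (γ m / k) ∑_{j ∈ S} e_j (max(0, g_j(w)) - μ_j)` with
respect to `p`, where `v j = g_j(w)` for `j ∈ S`. -/
def supergradient {m : ℕ} (γ : ℝ) (k : ℕ) (S : Finset (Fin m)) (v μ : Fin m → ℝ) : Fin m → ℝ :=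
  fun j => γ * μ j + γ * (m : ℝ) / (k : ℝ) * (if j ∈ S then max 0 (v j) - μ j else 0)

/-- The multiplicative update: `exp(ln p + η Δ)` elementwise, divided by its `ℓ¹` norm. -/
def multUpdate {m : ℕ} (η : ℝ) (p Δ : Fin m → ℝ) : Fin m → ℝ :=
  fun j => Real.exp (Real.log (p j) + η * Δ j) /
    ∑ l, |Real.exp (Real.log (p l) + η * Δ l)|

/-- One iteration of LightTouch, given the sampled stochastic subgradient `ξ` of `f`, constraint
index `i` and minibatch `S`. -/
def lightStep {d m : ℕ} (W : Set (E d)) (g : Fin m → E d → ℝ) (dg : Fin m → E d → E d)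
    (γ η : ℝ) (k : ℕ) (s : State d m) (ξ : E d) (i : Fin m) (S : Finset (Fin m)) :
    Counted (State d m) := do
  let u ← checkGrad dg i s.w
  let v ← forEach S (fun j => checkValue g j s.w)
  pure
    { w := proj W (s.w - η • (ξ + γ • u))
      p := multUpdate η s.p (supergradient γ k S v s.μ)
      μ := fun j => if j ∈ S then max 0 (v j) else s.μ j }

/-- The state of LightTouch after `t` iterations. -/
def lightIter {d m : ℕ} (W : Set (E d)) (g : Fin m → E d → ℝ) (dg : Fin m → E d → E d)
    (γ η : ℝ) (k : ℕ) (w₁ : E d) (ξ : ℕ → E d) (i : ℕ → Fin m) (S : ℕ → Finset (Fin m)) :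
    ℕ → Counted (State d m)
  | 0 => lightInit g w₁
  | t + 1 => do
    let s ← lightIter W g dg γ η k w₁ ξ i S t
    lightStep W g dg γ η k s (ξ t) (i t) (S t)

/-- `T` iterations of LightTouch, returning the average iterate `w̄ = (∑_{t=1}^T w^{(t)}) / T`. -/
def lightTouch {d m : ℕ} (W : Set (E d)) (g : Fin m → E d → ℝ) (dg : Fin m → E d → E d)
    (γ η : ℝ) (k T : ℕ) (w₁ : E d) (ξ : ℕ → E d) (i : ℕ → Fin m) (S : ℕ → Finset (Fin m)) :
    Counted (E d) where
  val := (T : ℝ)⁻¹ • ∑ t ∈ Finset.range T, (lightIter W g dg γ η k w₁ ξ i S t).val.w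
  checks := (lightIter W g dg γ η k w₁ ξ i S T).checks

/-! ### Randomness

Time is counted from `0`: `ℱ t` is the information available before iteration `t + 1`, in
which `ξ t`, `i t` and `S t` are sampled. -/

/-- `ξ 0, …, ξ (T - 1)` are stochastic subgradients of `f` along the iterates `w`: adapted, with
conditional mean in the subdifferential, and almost surely of norm at most `Gf`. -/
structure StochasticSubgradients {d : ℕ} {Ω : Type*} {mΩ : MeasurableSpace Ω} (P : Measure Ω)
    (ℱ : Filtration ℕ mΩ) (W : Set (E d)) (f : E d → ℝ) (Gf : ℝ) (T : ℕ)
    (w ξ : ℕ → Ω → E d) : Prop where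
  adapted : ∀ t < T, StronglyMeasurable[ℱ (t + 1)] (ξ t)
  unbiased : ∀ t < T, ∀ᵐ ω ∂P, (P[ξ t | ℱ t]) ω ∈ subdifferential W f (w t ω)
  bounded : ∀ t < T, ∀ᵐ ω ∂P, ‖ξ t ω‖ ≤ Gf

/-- `w₁` and `ξ` are the random inputs of a run of `T` iterations of FullTouch: an arbitrary
initial point of `W` and stochastic subgradients of `f` at the iterates. -/
structure FullExecution {d m : ℕ} {Ω : Type*} {mΩ : MeasurableSpace Ω} (P : Measure Ω)
    (ℱ : Filtration ℕ mΩ) (W : Set (E d)) (f : E d → ℝ) (g : Fin m → E d → ℝ)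
    (dg : Fin m → E d → E d) (sel : (Fin m → ℝ) → Fin m) (Gf γ η : ℝ) (T : ℕ)
    (w₁ : Ω → E d) (ξ : ℕ → Ω → E d) : Prop where
  init_measurable : StronglyMeasurable[ℱ 0] w₁
  init_mem : ∀ ω, w₁ ω ∈ W
  subgradients : StochasticSubgradients P ℱ W f Gf T
    (fun t ω => (fullIter W g dg sel γ η (w₁ ω) (fun s => ξ s ω) t).val) ξ

/-- `w₁`, `ξ`, `i`, `S` are the random inputs of a run of `T` iterations of LightTouch with
minibatches of size `k`: in each iteration, conditionally on the past, `ξ t` is a stochastic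
subgradient of `f` at the current iterate, the index `i t` is distributed according to the current
`p`, and `S t` is uniform among the `k`-element subsets of the constraints. -/
structure LightExecution {d m : ℕ} {Ω : Type*} {mΩ : MeasurableSpace Ω} (P : Measure Ω)
    (ℱ : Filtration ℕ mΩ) (W : Set (E d)) (f : E d → ℝ) (g : Fin m → E d → ℝ)
    (dg : Fin m → E d → E d) (Gf γ η : ℝ) (k T : ℕ)
    (w₁ : Ω → E d) (ξ : ℕ → Ω → E d) (i : ℕ → Ω → Fin m) (S : ℕ → Ω → Finset (Fin m)) :
    Prop where
  init_measurable : StronglyMeasurable[ℱ 0] w₁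
  init_mem : ∀ ω, w₁ ω ∈ W
  subgradients : StochasticSubgradients P ℱ W f Gf T
    (fun t ω => (lightIter W g dg γ η k (w₁ ω) (fun s => ξ s ω) (fun s => i s ω)
      (fun s => S s ω) t).val.w) ξ
  index_adapted : ∀ t < T, ∀ j, MeasurableSet[ℱ (t + 1)] {ω | i t ω = j}
  index_law : ∀ t < T, ∀ j,
    P[Set.indicator {ω | i t ω = j} (fun _ => (1 : ℝ)) | ℱ t] =ᵐ[P]
      fun ω => (lightIter W g dg γ η k (w₁ ω) (fun s => ξ s ω) (fun s => i s ω)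
        (fun s => S s ω) t).val.p j
  batch_card : ∀ t < T, ∀ ω, (S t ω).card = k
  batch_adapted : ∀ t < T, ∀ A, MeasurableSet[ℱ (t + 1)] {ω | S t ω = A}
  batch_law : ∀ t < T, ∀ A : Finset (Fin m), A.card = k →
    P[Set.indicator {ω | S t ω = A} (fun _ => (1 : ℝ)) | ℱ t] =ᵐ[P]
      fun _ => 1 / (m.choose k : ℝ)

/-! ### Parameters and guarantee -/

/-- The iteration count `T = ⌈c (1 + ln m) D² A² (1 + ln (1/δ)) / ε²⌉`. -/
def iterations (c : ℝ) (m : ℕ) (D A δ ε : ℝ) : ℕ :=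
  ⌈c * ((1 + Real.log m) * D ^ 2 * A ^ 2 * (1 + Real.log (1 / δ)) / ε ^ 2)⌉₊

/-- The minibatch size
`k = ⌈m (1 + ln m)^{3/4} √(1 + ln (1/δ)) √(1 + ln T) / T^{1/4}⌉`. -/
def minibatchSize (m : ℕ) (δ : ℝ) (T : ℕ) : ℕ :=
  ⌈(m : ℝ) * (1 + Real.log m) ^ (3 / 4 : ℝ) * Real.sqrt (1 + Real.log (1 / δ)) *
    Real.sqrt (1 + Real.log T) / (T : ℝ) ^ (1 / 4 : ℝ)⌉₊

/-- The bound on the number of constraint checks, up to the constant factor. -/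
def checksBound (m : ℕ) (D A δ ε : ℝ) (T : ℕ) : ℝ :=
  (1 + Real.log m) * D ^ 2 * A ^ 2 * (1 + Real.log (1 / δ)) / ε ^ 2 +
    (m : ℝ) * (1 + Real.log m) ^ (3 / 2 : ℝ) * D ^ (3 / 2 : ℝ) * A ^ (3 / 2 : ℝ) *
      (1 + Real.log (1 / δ)) ^ (5 / 4 : ℝ) / ε ^ (3 / 2 : ℝ) * Real.sqrt (1 + Real.log T)

/-- The guarantee on the average iterate `wbar` relative to the reference point `wstar`:
`f(Π_g(w̄)) - f(w*) ≤ h(w̄) - h(w*) ≤ ε` and `‖w̄ - Π_g(w̄)‖ ≤ ε / (γ ρ - L_f)`. -/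
def Guarantee {d m : ℕ} [NeZero m] (W : Set (E d)) (f : E d → ℝ) (g : Fin m → E d → ℝ)
    (γ ρ Lf ε : ℝ) (wstar wbar : E d) : Prop :=
  f (proj (feasible W g) wbar) - f wstar ≤ penalized f g γ wbar - penalized f g γ wstar ∧
  penalized f g γ wbar - penalized f g γ wstar ≤ ε ∧
  ‖wbar - proj (feasible W g) wbar‖ ≤ ε / (γ * ρ - Lf)

end LightTouch

end

open LightTouch

/-! The penalty is exact. If `w ∈ W` is infeasible and `v` is its projection onto the feasible set,
then `g` has a subgradient at `v` that is a multiple of `w - v`. Its norm is at least `ρ`, so `max 0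
(g w) ≥ ρ ‖w - v‖` (`mul_norm_sub_proj_le`). As `γ ρ > Lf`, projecting does not raise the objective
above `h w`, and the surplus `(γ ρ - Lf) ‖w - v‖` is at most the suboptimality of `w` for `h`
(`guarantee_of_penalized_le`). It remains to compare the average iterate with one feasible minimizer
`u` of `f`.

By Jensen (`penalized_average_sub_le`) it suffices that `∑ (f w_t + γ max 0 (g_j w_t) - f u) ≤ ε T`
for every `j`. This is a zero-sum game between `w` and the weights `p`: the sum is the regret of `w`
for the objective with the `p_t`-averaged constraint, plus the regret of `p` against the fixed index
`j`. The first is bounded by projected subgradient descent and Azuma's inequality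
(`measureReal_descent_le`), the second by multiplicative weights and Azuma's inequality
(`measureReal_weights_le`).

Small minibatches suffice because `μ` acts as a control variate: the noise of the supergradient is
only the staleness `max 0 (g_j w) - μ_j`, magnified by `m / k`. An iterate moves by at most `η (Gf +
γ Gg)` per step, and with high probability every index is refreshed within about `(m / k) log (m T /
δ)` steps. The noise is thus of order `(m / k)² η` up to logarithms, and `k` is chosen to make it
`O(A)`. Every error term is then a multiple of `D A √((1 + ln m) (1 + ln (1/δ)) T)`, which the
choice of `T` makes at most `ε T`.

In FullTouch `p` is the point mass at a largest constraint, so the second regret is nonpositive. It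
is run only if `k > m`, where even `T m` checks are within the bound. -/

namespace LightTouch

/-! ### Projections -/

section Projection

variable {d : ℕ} {K : Set (E d)}

lemma proj_spec (hc : IsClosed K) (hne : K.Nonempty) (x : E d) :
    proj K x ∈ K ∧ ∀ z ∈ K, ‖x - proj K x‖ ≤ ‖x - z‖ := by
  refine Classical.epsilon_spec (p := fun y => y ∈ K ∧ ∀ z ∈ K, ‖x - y‖ ≤ ‖x - z‖) ?_
  obtain ⟨y, hy, hxy⟩ := hc.exists_infDist_eq_dist hne x
  refine ⟨y, hy, fun z hz => ?_⟩
  rw [← dist_eq_norm, ← dist_eq_norm, ← hxy]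
  exact Metric.infDist_le_dist_of_mem hz

lemma proj_mem (hc : IsClosed K) (hne : K.Nonempty) (x : E d) : proj K x ∈ K :=
  (proj_spec hc hne x).1

lemma inner_sub_proj_nonpos (hcv : Convex ℝ K) (hc : IsClosed K) (x : E d) {z : E d} (hz : z ∈ K) :
    inner ℝ (x - proj K x) (z - proj K x) ≤ 0 := by
  have hs := proj_spec hc ⟨z, hz⟩ x
  refine (norm_eq_iInf_iff_real_inner_le_zero hcv hs.1).1 ?_ z hz
  have : Nonempty K := ⟨⟨z, hz⟩⟩
  refine le_antisymm (le_ciInf fun y => hs.2 y y.2) ?_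
  exact ciInf_le ⟨0, by rintro _ ⟨y, rfl⟩; exact norm_nonneg _⟩ (⟨proj K x, hs.1⟩ : K)

/-- Adding the variational inequalities at the two projections, each tested with the other, gives
`‖a - b‖² ≤ ⟨x - y, a - b⟩`; Cauchy-Schwarz finishes. -/
lemma norm_proj_sub_proj_le (hcv : Convex ℝ K) (hc : IsClosed K) (hne : K.Nonempty) (x y : E d) :
    ‖proj K x - proj K y‖ ≤ ‖x - y‖ := by
  have h1 := inner_sub_proj_nonpos hcv hc x (proj_mem hc hne y)
  have h2 := inner_sub_proj_nonpos hcv hc y (proj_mem hc hne x)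
  set a := proj K x
  set b := proj K y
  have h3 : ‖a - b‖ ^ 2 ≤ inner ℝ (x - y) (a - b) := by
    rw [← real_inner_self_eq_norm_sq]
    have e : inner ℝ (x - y) (a - b) - inner ℝ (a - b) (a - b)
        = - inner ℝ (x - a) (b - a) - inner ℝ (y - b) (a - b) := by
      rw [← inner_neg_right, neg_sub, ← inner_sub_left, ← inner_sub_left]
      congr 1; abel
    linarith
  have h4 := real_inner_le_norm (x - y) (a - b)
  by_contra! h
  have h5 : 0 ≤ ‖x - y‖ := norm_nonneg _
  nlinarith

lemma continuous_proj (hcv : Convex ℝ K) (hc : IsClosed K) (hne : K.Nonempty) :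
    Continuous (proj K) :=
  (LipschitzWith.of_dist_le_mul (K := 1) fun x y => by
    simpa [dist_eq_norm] using norm_proj_sub_proj_le hcv hc hne x y).continuous

lemma proj_of_mem (hc : IsClosed K) {x : E d} (hx : x ∈ K) : proj K x = x := by
  have h := (proj_spec hc ⟨x, hx⟩ x).2 x hx
  rw [sub_self, norm_zero] at h
  exact (sub_eq_zero.1 (norm_le_zero_iff.1 h)).symm

lemma norm_proj_sub_le (hcv : Convex ℝ K) (hc : IsClosed K) (x : E d) {z : E d} (hz : z ∈ K) :
    ‖proj K x - z‖ ≤ ‖x - z‖ := by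
  simpa [proj_of_mem hc hz] using norm_proj_sub_proj_le hcv hc ⟨z, hz⟩ x z

end Projection

/-! ### The constrained problem -/

section Problem

variable {d m : ℕ} [NeZero m] {W : Set (E d)} {f : E d → ℝ} {g : Fin m → E d → ℝ}

lemma le_maxConstraint (i : Fin m) (w : E d) : g i w ≤ maxConstraint g w :=
  Finset.le_sup' (fun i => g i w) (Finset.mem_univ i)

lemma maxConstraint_le {w : E d} {a : ℝ} (h : ∀ i, g i w ≤ a) : maxConstraint g w ≤ a :=
  Finset.sup'_le _ _ fun i _ => h i

lemma exists_eq_maxConstraint (w : E d) : ∃ i, maxConstraint g w = g i w := by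
  obtain ⟨i, -, hi⟩ := Finset.exists_mem_eq_sup' (Finset.univ_nonempty (α := Fin m))
    (fun i => g i w)
  exact ⟨i, hi⟩

lemma mem_feasible_iff {w : E d} : w ∈ feasible W g ↔ w ∈ W ∧ maxConstraint g w ≤ 0 :=
  and_congr_right fun _ => ⟨maxConstraint_le, fun h i => (le_maxConstraint i w).trans h⟩

lemma convexOn_maxConstraint (hg : ∀ i, ConvexOn ℝ W (g i)) : ConvexOn ℝ W (maxConstraint g) := by
  refine ⟨(hg 0).1, fun x hx y hy a b ha hb hab => maxConstraint_le fun i => ?_⟩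
  refine ((hg i).2 hx hy ha hb hab).trans ?_
  simp only [smul_eq_mul]
  gcongr <;> exact le_maxConstraint _ _

lemma convexOn_pos_part {φ : E d → ℝ} (hφ : ConvexOn ℝ W φ) :
    ConvexOn ℝ W fun w => max 0 (φ w) :=
  (convexOn_const 0 hφ.1).sup hφ

lemma convex_feasible (hg : ∀ i, ConvexOn ℝ W (g i)) : Convex ℝ (feasible W g) := by
  have h := (convexOn_maxConstraint hg).convex_le 0
  have e : feasible W g = {x | x ∈ W ∧ maxConstraint g x ≤ 0} := by
    ext; exact mem_feasible_iff
  rwa [e]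

omit [NeZero m] in
lemma isClosed_feasible (hW : IsClosed W) (hg : ∀ i, ContinuousOn (g i) W) :
    IsClosed (feasible W g) := by
  have e : feasible W g = W ∩ ⋂ i, W ∩ g i ⁻¹' Set.Iic 0 := by
    ext w
    simp only [feasible, Set.mem_ofPred_eq, Set.mem_inter_iff, Set.mem_iInter, Set.mem_preimage,
      Set.mem_Iic]
    exact ⟨fun h => ⟨h.1, fun i => ⟨h.1, h.2 i⟩⟩, fun h => ⟨h.1, fun i => (h.2 i).2⟩⟩
  rw [e]
  exact hW.inter (isClosed_iInter fun i => (hg i).preimage_isClosed_of_isClosed hW isClosed_Iic)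

/-- The linear error bound: if the subgradients of `max_i g_i` have norm at least `ρ` on the
boundary of the feasible set, then the violation dominates `ρ` times the distance to that set. -/
lemma mul_norm_sub_proj_le (hg : ∀ i, ConvexOn ℝ W (g i)) (hF : IsClosed (feasible W g))
    (hne : (feasible W g).Nonempty) {ρ : ℝ}
    (hρ : ∀ w ∈ W, maxConstraint g w = 0 →
      ∀ v ∈ subdifferential W (maxConstraint g) w, ρ ≤ ‖v‖)
    {w : E d} (hw : w ∈ W) :
    ρ * ‖w - proj (feasible W g) w‖ ≤ max 0 (maxConstraint g w) := by
  by_cases hwF : w ∈ feasible W g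
  · simp [proj_of_mem hF hwF]
  set G := maxConstraint g
  have hG : ConvexOn ℝ W G := convexOn_maxConstraint hg
  set v := proj (feasible W g) w with hv
  have hvF : v ∈ feasible W g := proj_mem hF hne w
  have hvW : v ∈ W := hvF.1
  have hr : 0 < ‖w - v‖ := by
    rw [norm_pos_iff, sub_ne_zero]
    rintro h; exact hwF (h ▸ hvF)
  set r := ‖w - v‖ with hrdef
  -- `L = 0` is the hyperplane through `v` that supports the feasible set; every point of `W` with
  -- `L > 0` is infeasible.
  set L : E d → ℝ := fun x => inner ℝ (w - v) (x - v) with hL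
  have hLw : L w = r ^ 2 := real_inner_self_eq_norm_sq _
  have hLv : L v = 0 := by simp [hL]
  have hLcomb : ∀ (x y : E d) (a b : ℝ), a + b = 1 → L (a • x + b • y) = a * L x + b * L y := by
    intro x y a b hab
    have : a • x + b • y - v = a • (x - v) + b • (y - v) := by
      rw [smul_sub, smul_sub, sub_add_sub_comm, ← add_smul, hab, one_smul]
    simp only [hL, this, inner_add_right, real_inner_smul_right]
  have hpos : ∀ x ∈ W, 0 < L x → 0 < G x := by
    intro x hx hLx
    by_contra! h
    exact absurd (inner_sub_proj_nonpos (convex_feasible hg) hF w (mem_feasible_iff.2 ⟨hx, h⟩))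
      (not_le.2 hLx)
  have hGw : 0 < G w := hpos w hw (by rw [hLw]; positivity)
  -- If `G x < 0` on the hyperplane, moving from `x` towards `w` by the fraction `θ` at which the
  -- chord of `G` vanishes gives a point with `L > 0` and `G ≤ 0`, against `hpos`.
  have hzero : ∀ x ∈ W, L x = 0 → 0 ≤ G x := by
    intro x hx hLx
    by_contra! h
    set θ := -G x / (G w - G x) with hθ
    have hd : 0 < G w - G x := by linarith
    have hθ0 : 0 < θ := div_pos (by linarith) hd
    have hθ1 : θ ≤ 1 := by rw [hθ, div_le_one hd]; linarith
    have hmem := hG.1 hx hw (sub_nonneg.2 hθ1) hθ0.le (by ring)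
    have h1 := hG.2 hx hw (sub_nonneg.2 hθ1) hθ0.le (by ring)
    have h2 := hpos _ hmem (by rw [hLcomb _ _ _ _ (by ring), hLx, hLw]; positivity)
    simp only [smul_eq_mul] at h1
    have h3 : (1 - θ) * G x + θ * G w = 0 := by
      rw [hθ]; field_simp; ring
    linarith
  have hGv : G v = 0 := le_antisymm (mem_feasible_iff.1 hvF).2 (hzero v hvW hLv)
  -- The infimum `s` of these slopes is the largest multiple of `L` below `G` on the side `L > 0`.
  -- It is a minorant on all of `W`, so `s • (w - v)` is a subgradient at `v`. Hence `ρ ≤ s r`, and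
  -- evaluating the minorant at `w` gives `ρ r ≤ s r² ≤ G w`.
  set Q : Set ℝ := (fun x => G x / L x) '' {x | x ∈ W ∧ 0 < L x} with hQ
  have hQne : Q.Nonempty := ⟨_, w, ⟨hw, by rw [hLw]; positivity⟩, rfl⟩
  have hQ0 : ∀ q ∈ Q, 0 ≤ q := by
    rintro _ ⟨x, ⟨hx, hLx⟩, rfl⟩
    exact div_nonneg (hpos x hx hLx).le hLx.le
  have hQb : BddBelow Q := ⟨0, hQ0⟩
  set s := sInf Q with hs
  have hs0 : 0 ≤ s := le_csInf hQne hQ0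
  have hsub : ∀ x ∈ W, s * L x ≤ G x := by
    intro x hx
    rcases lt_trichotomy (L x) 0 with hx0 | hx0 | hx0
    -- The segment from `x` to a point `y` with `L y > 0` crosses the hyperplane, where `G ≥ 0`; by
    -- convexity the slope at `x` is at most the slope at `y`.
    · have : -G x / -L x ≤ s := by
        refine le_csInf hQne ?_
        rintro _ ⟨y, ⟨hy, hLy⟩, rfl⟩
        rw [div_le_div_iff₀ (neg_pos.2 hx0) hLy]
        have hD : 0 < L y - L x := by linarith
        have ha : 0 ≤ L y / (L y - L x) := div_nonneg hLy.le hD.le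
        have hb : 0 ≤ -L x / (L y - L x) := div_nonneg (by linarith) hD.le
        have hab : L y / (L y - L x) + -L x / (L y - L x) = 1 := by
          field_simp; ring
        have h1 := hG.2 hx hy ha hb hab
        have h2 := hzero _ (hG.1 hx hy ha hb hab) (by
          rw [hLcomb _ _ _ _ hab]; field_simp; ring)
        have h3 := h2.trans h1
        simp only [smul_eq_mul] at h3
        have h4 : L y / (L y - L x) * G x + -L x / (L y - L x) * G y
            = (L y * G x - L x * G y) / (L y - L x) := by field_simp; ring
        rw [h4] at h3
        have h5 : 0 ≤ L y * G x - L x * G y := by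
          by_contra! h
          exact absurd h3 (not_le.2 (div_neg_of_neg_of_pos h hD))
        linarith
      rw [div_le_iff₀ (neg_pos.2 hx0)] at this
      linarith
    · rw [hx0, mul_zero]; exact hzero x hx hx0
    · exact (le_div_iff₀ hx0).1 (csInf_le hQb ⟨x, ⟨hx, hx0⟩, rfl⟩)
  have hmem : s • (w - v) ∈ subdifferential W G v := by
    intro x hx
    rw [hGv, zero_add, real_inner_smul_left]
    exact hsub x hx
  have hle := hρ v hvW hGv _ hmem
  rw [norm_smul, Real.norm_eq_abs, abs_of_nonneg hs0] at hle
  have h6 := hsub w hw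
  rw [hLw] at h6
  calc ρ * r ≤ (s * r) * r := by gcongr
    _ = s * r ^ 2 := by ring
    _ ≤ G w := h6
    _ ≤ max 0 (G w) := le_max_right _ _

/-- Approximate minimization of the penalized objective over the feasible points yields the
guarantee relative to each of them. -/
lemma guarantee_of_penalized_le (hWc : IsClosed W)
    (hg : ∀ i, ConvexOn ℝ W (g i)) {Lf : ℝ≥0} (hf : LipschitzOnWith Lf f W)
    (hgc : ∀ i, ContinuousOn (g i) W) {ρ : ℝ} (hρ0 : 0 < ρ)
    (hρ : ∀ w ∈ W, maxConstraint g w = 0 →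
      ∀ v ∈ subdifferential W (maxConstraint g) w, ρ ≤ ‖v‖)
    {γ : ℝ} (hγ : (Lf : ℝ) / ρ < γ) {ε : ℝ}
    {w wstar wopt : E d} (hw : w ∈ W) (hstar : wstar ∈ feasible W g)
    (hopt : ∀ x ∈ feasible W g, f wopt ≤ f x)
    (h : penalized f g γ w - f wopt ≤ ε) :
    Guarantee W f g γ ρ Lf ε wstar w := by
  have hF := isClosed_feasible hWc hgc
  have hb := mul_norm_sub_proj_le hg hF ⟨_, hstar⟩ hρ hw
  have hvF := proj_mem hF ⟨_, hstar⟩ w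
  set v := proj (feasible W g) w
  have hγρ : (Lf : ℝ) < γ * ρ := (div_lt_iff₀ hρ0).1 hγ
  have hL : |f w - f v| ≤ Lf * ‖w - v‖ := by
    simpa [dist_eq_norm, Real.dist_eq] using hf.dist_le_mul w hw v hvF.1
  have hps : penalized f g γ wstar = f wstar := by
    simp [penalized, max_eq_left (mem_feasible_iff.1 hstar).2]
  have hγ0 : 0 < γ := lt_of_le_of_lt (by positivity) hγ
  have hb' : γ * ρ * ‖w - v‖ ≤ γ * max 0 (maxConstraint g w) := by
    rw [mul_assoc]; gcongr
  have hn : 0 ≤ ‖w - v‖ := norm_nonneg _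
  have hLn : Lf * ‖w - v‖ ≤ γ * ρ * ‖w - v‖ := by gcongr
  have h1 := abs_le.1 hL
  -- `h2` passes from the optimum to `wstar`. `h3` keeps `f v` from falling below the optimal value;
  -- the distance bound needs this, and a bound on `h w - h wstar` alone would not give it.
  have h2 := hopt _ hstar
  have h3 := hopt _ hvF
  refine ⟨?_, ?_, ?_⟩
  · rw [hps, penalized]; linarith
  · rw [hps]; linarith
  · rw [le_div_iff₀ (by linarith)]
    rw [penalized] at h
    linarith

omit [NeZero m] in
lemma exists_optimal (hWc : IsClosed W) {D : ℝ} (hD : ∀ w ∈ W, ∀ w' ∈ W, ‖w - w'‖ ≤ D)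
    (hf : ContinuousOn f W) (hgc : ∀ i, ContinuousOn (g i) W) (hne : (feasible W g).Nonempty) :
    ∃ w ∈ feasible W g, ∀ x ∈ feasible W g, f w ≤ f x := by
  have hsub : feasible W g ⊆ W := fun _ h => h.1
  have hb : Bornology.IsBounded (feasible W g) :=
    (Metric.isBounded_iff.2 ⟨D, fun x hx y hy => by
      simpa [dist_eq_norm] using hD x (hsub hx) y (hsub hy)⟩)
  have hc := Metric.isCompact_of_isClosed_isBounded (isClosed_feasible hWc hgc) hb
  obtain ⟨w, hw, hmin⟩ := hc.exists_isMinOn hne (hf.mono hsub)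
  exact ⟨w, hw, fun x hx => hmin hx⟩

end Problem

/-! ### Martingale differences -/

section Martingale

variable {Ω : Type*} {mΩ : MeasurableSpace Ω} {P : Measure Ω} [IsProbabilityMeasure P]
  {ℱ : Filtration ℕ mΩ}

lemma integrable_of_ae_bound {F : Type*} [NormedAddCommGroup F] {Y : Ω → F}
    (hY : AEStronglyMeasurable Y P) {C : ℝ} (hC : ∀ᵐ ω ∂P, ‖Y ω‖ ≤ C) : Integrable Y P :=
  (integrable_const C).mono' hY hC

/-- Adapted random variables whose conditional means given the past vanish. -/
structure MartingaleDifferences (P : Measure Ω) (ℱ : Filtration ℕ mΩ) (T : ℕ)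
    (X : ℕ → Ω → ℝ) : Prop where
  adapted : ∀ t < T, StronglyMeasurable[ℱ (t + 1)] (X t)
  condExp_eq_zero : ∀ t < T, P[X t | ℱ t] =ᵐ[P] 0

/-- Convexity of `exp` on `[-b, b]` gives `exp (l x) ≤ cosh (l b) + (x / b) sinh (l b)`. The linear
term has conditional mean zero, and `cosh y ≤ exp (y² / 2)`. Measurability and boundedness are
carried through the induction because the past factor is pulled out of a conditional expectation. -/
lemma integral_exp_sum_le {T : ℕ} {X : ℕ → Ω → ℝ} (hX : MartingaleDifferences P ℱ T X) {b : ℝ}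
    (hb : 0 < b) (hXb : ∀ t < T, ∀ᵐ ω ∂P, |X t ω| ≤ b) (l : ℝ) {n : ℕ} (hn : n ≤ T) :
    StronglyMeasurable[ℱ n] (fun ω => Real.exp (l * ∑ t ∈ Finset.range n, X t ω)) ∧
    (∀ᵐ ω ∂P, ‖Real.exp (l * ∑ t ∈ Finset.range n, X t ω)‖ ≤ Real.exp (|l| * (n * b))) ∧
    ∫ ω, Real.exp (l * ∑ t ∈ Finset.range n, X t ω) ∂P ≤ Real.exp (n * (l * b) ^ 2 / 2) := by
  induction n with
  | zero => simp [stronglyMeasurable_const]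
  | succ n ih =>
    obtain ⟨hm, hbd, hint⟩ := ih (by omega)
    have hXm := hX.adapted n hn
    have hXn := hXb n hn
    have hsplit : ∀ ω, Real.exp (l * ∑ t ∈ Finset.range (n + 1), X t ω) =
        Real.exp (l * ∑ t ∈ Finset.range n, X t ω) * Real.exp (l * X n ω) := fun ω => by
      rw [Finset.sum_range_succ, mul_add, Real.exp_add]
    simp_rw [hsplit]
    set Z : Ω → ℝ := fun ω => Real.exp (l * ∑ t ∈ Finset.range n, X t ω) with hZ
    have hXi : Integrable (X n) P :=
      integrable_of_ae_bound (hXm.mono (ℱ.le _)).aestronglyMeasurable hXn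
    have hZi : Integrable Z P :=
      integrable_of_ae_bound (hm.mono (ℱ.le _)).aestronglyMeasurable hbd
    have hmeas : StronglyMeasurable[ℱ (n + 1)] fun ω => Z ω * Real.exp (l * X n ω) :=
      (hm.mono (ℱ.mono (Nat.le_succ n))).mul
        (Real.continuous_exp.comp_stronglyMeasurable (hXm.const_mul l))
    have hbound : ∀ᵐ ω ∂P, ‖Z ω * Real.exp (l * X n ω)‖ ≤
        Real.exp (|l| * ((n + 1 : ℕ) * b)) := by
      filter_upwards [hbd, hXn] with ω h1 h2
      rw [norm_mul, Nat.cast_succ, add_mul, one_mul, mul_add, Real.exp_add]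
      refine mul_le_mul h1 ?_ (norm_nonneg _) (Real.exp_pos _).le
      rw [Real.norm_eq_abs, Real.abs_exp]
      refine Real.exp_le_exp.2 ?_
      calc l * X n ω ≤ |l * X n ω| := le_abs_self _
        _ = |l| * |X n ω| := abs_mul _ _
        _ ≤ |l| * b := by gcongr
    refine ⟨hmeas, hbound, ?_⟩
    have hZX : Integrable (fun ω => Z ω * X n ω) P :=
      hXi.bdd_mul (hm.mono (ℱ.le _)).aestronglyMeasurable hbd
    have hZX0 : ∫ ω, Z ω * X n ω ∂P = 0 := by
      have h1 := condExp_stronglyMeasurable_mul_of_bound (ℱ.le n) hm hXi _ hbd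
      have h2 := integral_condExp (ℱ.le n) (f := Z * X n) (μ := P)
      have h3 : ∫ ω, Z ω * X n ω ∂P = ∫ ω, (Z * X n) ω ∂P := rfl
      rw [h3, ← h2]
      refine integral_eq_zero_of_ae (h1.trans ?_)
      filter_upwards [hX.condExp_eq_zero n hn] with ω hω
      simp [hω]
    calc ∫ ω, Z ω * Real.exp (l * X n ω) ∂P
        ≤ ∫ ω, (Z ω * Real.cosh (l * b) + Real.sinh (l * b) / b * (Z ω * X n ω)) ∂P := by
          refine integral_mono_ae
            (integrable_of_ae_bound (hmeas.mono (ℱ.le _)).aestronglyMeasurable hbound)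
            ((hZi.mul_const _).add (hZX.const_mul _)) ?_
          filter_upwards [hXn] with ω hω
          have h1 := Real.exp_mul_le_cosh_add_mul_sinh (t := X n ω / b)
            (by rwa [abs_div, abs_of_pos hb, div_le_one hb]) (l * b)
          have h2 : X n ω / b * (l * b) = l * X n ω := by field_simp
          rw [h2] at h1
          calc Z ω * Real.exp (l * X n ω)
              ≤ Z ω * (Real.cosh (l * b) + X n ω / b * Real.sinh (l * b)) :=
                mul_le_mul_of_nonneg_left h1 (Real.exp_pos _).le
            _ = _ := by ring
      _ = (∫ ω, Z ω ∂P) * Real.cosh (l * b) := by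
          rw [integral_add (hZi.mul_const _) (hZX.const_mul _), integral_mul_const,
            integral_const_mul, hZX0, mul_zero, add_zero]
      _ ≤ Real.exp (n * (l * b) ^ 2 / 2) * Real.exp ((l * b) ^ 2 / 2) :=
          mul_le_mul hint (Real.cosh_le_exp_half_sq _) (Real.cosh_pos _).le (Real.exp_pos _).le
      _ = Real.exp ((n + 1 : ℕ) * (l * b) ^ 2 / 2) := by
          rw [← Real.exp_add, Nat.cast_succ]; ring_nf

/-- The Azuma-Hoeffding inequality. -/
lemma measureReal_sum_ge_le {T : ℕ} (hT : 0 < T) {X : ℕ → Ω → ℝ}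
    (hX : MartingaleDifferences P ℱ T X) {b : ℝ}
    (hb : 0 < b) (hXb : ∀ t < T, ∀ᵐ ω ∂P, |X t ω| ≤ b) {L : ℝ} (hL : 0 ≤ L) :
    P.real {ω | b * Real.sqrt (2 * T * L) ≤ ∑ t ∈ Finset.range T, X t ω} ≤ Real.exp (-L) := by
  set q := Real.sqrt (2 * T * L) with hq
  have hT' : (0 : ℝ) < T := Nat.cast_pos.2 hT
  have hq2 : q ^ 2 = 2 * T * L := Real.sq_sqrt (by positivity)
  -- `l = q / (T b)` minimizes the Chernoff exponent `-l b q + T (l b)² / 2`; the minimum is `-q² /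
  -- (2 T) = -L`.
  obtain ⟨hm, hbd, hint⟩ := integral_exp_sum_le hX hb hXb (q / (T * b)) le_rfl
  refine (measure_ge_le_exp_mul_mgf (b * q) (t := q / (T * b)) (by positivity)
    (integrable_of_ae_bound (hm.mono (ℱ.le _)).aestronglyMeasurable hbd)).trans ?_
  rw [mgf]
  refine (mul_le_mul_of_nonneg_left hint (Real.exp_pos _).le).trans_eq ?_
  rw [← Real.exp_add]
  congr 1
  have : -(q / (T * b)) * (b * q) + T * (q / (T * b) * b) ^ 2 / 2 = - (q ^ 2) / (2 * T) := by
    field_simp; ring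
  rw [this, hq2]
  field_simp

/-- The probability that `n` consecutive events of conditional probability `r` all occur. -/
lemma measureReal_forall_mem_eq_pow {r : ℝ} {T : ℕ} {B : ℕ → Set Ω}
    (hB : ∀ t < T, MeasurableSet[ℱ (t + 1)] (B t))
    (hBr : ∀ t < T, P[(B t).indicator (fun _ => (1 : ℝ)) | ℱ t] =ᵐ[P] fun _ => r)
    {a n : ℕ} (han : a + n ≤ T) :
    MeasurableSet[ℱ (a + n)] {ω | ∀ s < n, ω ∈ B (a + s)} ∧
    P.real {ω | ∀ s < n, ω ∈ B (a + s)} = r ^ n := by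
  induction n with
  | zero => simp
  | succ n ih =>
    obtain ⟨hm, hp⟩ := ih (by omega)
    have hlt : a + n < T := by omega
    have he : {ω | ∀ s < n + 1, ω ∈ B (a + s)} = {ω | ∀ s < n, ω ∈ B (a + s)} ∩ B (a + n) := by
      ext ω
      simp only [Set.mem_ofPred_eq, Set.mem_inter_iff, Nat.lt_succ_iff_lt_or_eq]
      exact ⟨fun h => ⟨fun s hs => h s (Or.inl hs), h n (Or.inr rfl)⟩,
        fun h s hs => hs.elim (h.1 s) fun e => e ▸ h.2⟩
    rw [he]
    have hBm := hB _ hlt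
    refine ⟨MeasurableSet.inter (ℱ.mono (by omega) _ hm) hBm, ?_⟩
    set M := {ω | ∀ s < n, ω ∈ B (a + s)}
    have hi : Integrable ((B (a + n)).indicator (fun _ => (1 : ℝ))) P :=
      (integrable_const _).indicator (ℱ.le _ _ hBm)
    have h1 := setIntegral_condExp (ℱ.le (a + n)) hi hm
    rw [setIntegral_indicator (ℱ.le _ _ hBm)] at h1
    rw [setIntegral_congr_ae (g := fun _ => r) (ℱ.le _ _ hm)
      ((hBr _ hlt).mono fun ω hω _ => hω)] at h1
    simp only [integral_const, MeasurableSet.univ, measureReal_restrict_apply, Set.univ_inter,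
      smul_eq_mul, mul_one] at h1
    rw [← h1, hp, pow_succ]

end Martingale

/-! ### Regret bounds -/

section Regret

lemma norm_proj_step_sub_le {d : ℕ} {W : Set (E d)} (hcv : Convex ℝ W) (hc : IsClosed W)
    {η G : ℝ} (hη : 0 ≤ η) {w Δ : E d} (hw : w ∈ W) (hΔ : ‖Δ‖ ≤ G) :
    ‖proj W (w - η • Δ) - w‖ ≤ η * G := by
  refine (norm_proj_sub_le hcv hc _ hw).trans ?_
  rw [sub_sub_cancel_left, norm_neg, norm_smul, Real.norm_eq_abs, abs_of_nonneg hη]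
  gcongr

/-- The regret bound of projected subgradient descent. -/
lemma sum_inner_le {d : ℕ} {W : Set (E d)} (hcv : Convex ℝ W) (hc : IsClosed W) {D : ℝ}
    (hD : ∀ w ∈ W, ∀ w' ∈ W, ‖w - w'‖ ≤ D) {η G : ℝ} (hη : 0 < η) {T : ℕ} {w Δ : ℕ → E d}
    (hw0 : w 0 ∈ W) (hw : ∀ t < T, w (t + 1) = proj W (w t - η • Δ t))
    (hΔ : ∀ t < T, ‖Δ t‖ ≤ G) {u : E d} (hu : u ∈ W) :
    ∑ t ∈ Finset.range T, inner ℝ (Δ t) (w t - u) ≤ D ^ 2 / (2 * η) + η * T * G ^ 2 / 2 := by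
  -- The potential `‖w n - u‖²` telescopes: expanding the square before projecting, which does not
  -- increase the distance to `u`, bounds each summand by the drop of the potential plus `η G² / 2`.
  have key : ∀ n ≤ T, ∑ t ∈ Finset.range n, inner ℝ (Δ t) (w t - u) ≤
      (‖w 0 - u‖ ^ 2 - ‖w n - u‖ ^ 2) / (2 * η) + η * n * G ^ 2 / 2 := by
    intro n hn
    induction n with
    | zero => simp
    | succ n ih =>
      have hlt : n < T := hn
      rw [Finset.sum_range_succ]
      have h1 : ‖w (n + 1) - u‖ ^ 2 ≤ ‖w n - η • Δ n - u‖ ^ 2 := by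
        rw [hw n hlt]
        gcongr
        exact norm_proj_sub_le hcv hc _ hu
      have h2 : ‖w n - η • Δ n - u‖ ^ 2 =
          ‖w n - u‖ ^ 2 - 2 * η * inner ℝ (Δ n) (w n - u) + η ^ 2 * ‖Δ n‖ ^ 2 := by
        rw [sub_right_comm, norm_sub_sq_real, real_inner_smul_right, norm_smul,
          Real.norm_eq_abs, mul_pow, sq_abs, real_inner_comm]
        ring
      have h3 : ‖Δ n‖ ^ 2 ≤ G ^ 2 := by gcongr; exact hΔ n hlt
      have h4 : η ^ 2 * ‖Δ n‖ ^ 2 ≤ η ^ 2 * G ^ 2 := by gcongr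
      have h5 : inner ℝ (Δ n) (w n - u) ≤
          (‖w n - u‖ ^ 2 - ‖w (n + 1) - u‖ ^ 2) / (2 * η) + η * G ^ 2 / 2 := by
        rw [div_add' _ _ _ (by positivity), le_div_iff₀ (by positivity)]
        nlinarith
      have h6 := ih hlt.le
      push_cast
      calc _ ≤ _ := add_le_add h6 h5
        _ = _ := by ring
  refine (key T le_rfl).trans ?_
  gcongr
  have h7 : ‖w 0 - u‖ ^ 2 ≤ D ^ 2 := by gcongr; exact hD _ hw0 _ hu
  linarith [sq_nonneg ‖w T - u‖]

/-! ### Multiplicative weights -/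

section MultiplicativeWeights

variable {m : ℕ} [NeZero m]

lemma sum_abs_exp_pos (y : Fin m → ℝ) : 0 < ∑ l, |Real.exp (y l)| :=
  Finset.sum_pos (fun _ _ => abs_pos.2 (Real.exp_pos _).ne') Finset.univ_nonempty

lemma multUpdate_pos (η : ℝ) (p x : Fin m → ℝ) (j : Fin m) : 0 < multUpdate η p x j :=
  div_pos (Real.exp_pos _) (sum_abs_exp_pos _)

lemma sum_multUpdate (η : ℝ) (p x : Fin m → ℝ) : ∑ j, multUpdate η p x j = 1 := by
  unfold multUpdate
  rw [← Finset.sum_div]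
  simp only [Real.abs_exp]
  refine div_self (ne_of_gt ?_)
  simpa only [Real.abs_exp] using sum_abs_exp_pos fun l => Real.log (p l) + η * x l

omit [NeZero m] in
-- Hoeffding's lemma for the distribution `p`. The centred values lie in `[-2B, 2B]`, whence the
-- exponent `(2 η B)² / 2 = 2 η² B²`; no smallness of `η B` is required.
lemma sum_mul_exp_le {p x : Fin m → ℝ} (hp : ∀ j, 0 < p j) (hp1 : ∑ j, p j = 1) {B : ℝ}
    (hB : 0 < B) (hx : ∀ j, |x j| ≤ B) (η : ℝ) :
    ∑ j, p j * Real.exp (η * x j) ≤ Real.exp (η * ∑ j, p j * x j + 2 * η ^ 2 * B ^ 2) := by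
  set a := ∑ j, p j * x j with ha
  have haB : |a| ≤ B := by
    calc |a| ≤ ∑ j, |p j * x j| := Finset.abs_sum_le_sum_abs _ _
      _ ≤ ∑ j, p j * B := Finset.sum_le_sum fun j _ => by
          rw [abs_mul, abs_of_pos (hp j)]
          exact mul_le_mul_of_nonneg_left (hx j) (hp j).le
      _ = B := by rw [← Finset.sum_mul, hp1, one_mul]
  have hy : ∀ j, Real.exp (η * x j) ≤ Real.exp (η * a) *
      (Real.cosh (η * (2 * B)) + (x j - a) / (2 * B) * Real.sinh (η * (2 * B))) := by
    intro j
    have h1 : |(x j - a) / (2 * B)| ≤ 1 := by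
      rw [abs_div, abs_of_pos (by positivity : 0 < 2 * B), div_le_one (by positivity)]
      have := abs_sub (x j) a
      linarith [hx j]
    have h2 := Real.exp_mul_le_cosh_add_mul_sinh h1 (η * (2 * B))
    have h3 : (x j - a) / (2 * B) * (η * (2 * B)) = η * x j - η * a := by field_simp
    rw [h3] at h2
    calc Real.exp (η * x j) = Real.exp (η * a) * Real.exp (η * x j - η * a) := by
          rw [← Real.exp_add]; ring_nf
      _ ≤ _ := by gcongr
  calc ∑ j, p j * Real.exp (η * x j)
      ≤ ∑ j, p j * (Real.exp (η * a) *
        (Real.cosh (η * (2 * B)) + (x j - a) / (2 * B) * Real.sinh (η * (2 * B)))) :=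
        Finset.sum_le_sum fun j _ => mul_le_mul_of_nonneg_left (hy j) (hp j).le
    _ = Real.exp (η * a) * ((∑ j, p j) * Real.cosh (η * (2 * B)) +
        (∑ j, p j * x j - (∑ j, p j) * a) * (Real.sinh (η * (2 * B)) / (2 * B))) := by
        generalize Real.exp (η * a) = K
        rw [Finset.sum_mul, Finset.sum_mul, ← Finset.sum_sub_distrib, Finset.sum_mul,
          ← Finset.sum_add_distrib, Finset.mul_sum]
        exact Finset.sum_congr rfl fun j _ => by ring
    _ = Real.exp (η * a) * Real.cosh (η * (2 * B)) := by rw [hp1, ← ha]; ring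
    _ ≤ Real.exp (η * a) * Real.exp ((η * (2 * B)) ^ 2 / 2) := by
        gcongr; exact Real.cosh_le_exp_half_sq _
    _ = _ := by rw [← Real.exp_add]; ring_nf

/-- The potential is the log-weight of `j`: it grows by `η x j` minus the logarithm of the
normalization, which `sum_mul_exp_le` controls. -/
lemma le_log_multUpdate_sub_log {p x : Fin m → ℝ} (hp : ∀ j, 0 < p j) (hp1 : ∑ j, p j = 1)
    {B : ℝ} (hB : 0 < B) (hx : ∀ j, |x j| ≤ B) (η : ℝ) (j : Fin m) :
    η * (x j - ∑ l, p l * x l) ≤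
      Real.log (multUpdate η p x j) - Real.log (p j) + 2 * η ^ 2 * B ^ 2 := by
  have hZ : ∑ l, |Real.exp (Real.log (p l) + η * x l)| = ∑ l, p l * Real.exp (η * x l) :=
    Finset.sum_congr rfl fun l _ => by rw [Real.abs_exp, Real.exp_add, Real.exp_log (hp l)]
  have hpos := sum_abs_exp_pos fun l => Real.log (p l) + η * x l
  have hle := Real.log_le_log (hZ ▸ hpos) (sum_mul_exp_le hp hp1 hB hx η)
  rw [Real.log_exp] at hle
  rw [multUpdate, Real.log_div (Real.exp_pos _).ne' hpos.ne', Real.log_exp, hZ]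
  linarith

/-- The regret bound of the multiplicative weights update. -/
lemma sum_sub_sum_mul_le {η B : ℝ} (hη : 0 < η) (hB : 0 < B) {T : ℕ} {p x : ℕ → Fin m → ℝ}
    (hp0 : ∀ j, p 0 j = 1 / m) (hp : ∀ t < T, p (t + 1) = multUpdate η (p t) (x t))
    (hx : ∀ t < T, ∀ j, |x t j| ≤ B) (j : Fin m) :
    ∑ t ∈ Finset.range T, (x t j - ∑ l, p t l * x t l) ≤
      Real.log m / η + 2 * η * T * B ^ 2 := by
  have hm : (0 : ℝ) < m := Nat.cast_pos.2 (NeZero.pos m)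
  have hpos : ∀ t ≤ T, (∀ l, 0 < p t l) ∧ ∑ l, p t l = 1 := by
    intro t ht
    cases t with
    | zero => exact ⟨fun l => by rw [hp0]; positivity, by simp [hp0, hm.ne']⟩
    | succ t => rw [hp t ht]; exact ⟨multUpdate_pos _ _ _, sum_multUpdate _ _ _⟩
  have key : ∀ n ≤ T, η * ∑ t ∈ Finset.range n, (x t j - ∑ l, p t l * x t l) ≤
      Real.log (p n j) - Real.log (p 0 j) + n * (2 * η ^ 2 * B ^ 2) := by
    intro n hn
    induction n with
    | zero => simp
    | succ n ih =>
      have hlt : n < T := hn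
      have h1 := le_log_multUpdate_sub_log (hpos n hlt.le).1 (hpos n hlt.le).2 hB (hx n hlt) η j
      rw [← hp n hlt] at h1
      rw [Finset.sum_range_succ, mul_add]
      push_cast
      linarith [ih hlt.le]
  have h1 := key T le_rfl
  -- The log-weight starts at `-log m` and never exceeds `0`, so its total growth is at most `log
  -- m`.
  have h2 : Real.log (p T j) ≤ 0 := by
    refine Real.log_nonpos ((hpos T le_rfl).1 j).le ?_
    rw [← (hpos T le_rfl).2]
    exact Finset.single_le_sum (fun l _ => ((hpos T le_rfl).1 l).le) (Finset.mem_univ j)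
  rw [hp0 j, one_div, Real.log_inv] at h1
  have h3 : Real.log m / η + 2 * η * T * B ^ 2 = (Real.log m + T * (2 * η ^ 2 * B ^ 2)) / η := by
    field_simp
  rw [h3, le_div_iff₀ hη]
  linarith

end MultiplicativeWeights

/-- If `μ` remembers past values of a slowly varying sequence `u` and was refreshed at least once
during the last `n` steps, then it is accurate. -/
lemma abs_sub_le_of_refreshed {u μ : ℕ → ℝ} {R : ℕ → Prop} {T : ℕ} {a : ℝ} (ha : 0 ≤ a)
    (hu : ∀ t < T, |u (t + 1) - u t| ≤ a) (hμ0 : μ 0 = u 0)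
    (hμR : ∀ t < T, R t → μ (t + 1) = u t) (hμn : ∀ t < T, ¬ R t → μ (t + 1) = μ t)
    {t n : ℕ} (ht : t ≤ T) (h : t ≤ n ∨ ∃ b, t = b + n ∧ ∃ s < n, R (b + s)) :
    |u t - μ t| ≤ n * a := by
  induction t generalizing n with
  | zero => rw [hμ0, sub_self, abs_zero]; positivity
  | succ t ih =>
    have hlt : t < T := ht
    obtain ⟨n, rfl⟩ : ∃ n', n = n' + 1 := by
      rcases h with h | ⟨b, -, s, hs, -⟩
      · exact ⟨n - 1, by omega⟩
      · exact ⟨n - 1, by omega⟩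
    have h0 := hu t hlt
    push_cast
    -- A refresh at step `t` stores `u t`, already one step old at time `t + 1`. Without one, the
    -- refresh in the window lies before `t`, and the window shortens by one. A window reaching back
    -- to time `0` needs no refresh, since `μ 0` is exact.
    by_cases hR : R t
    · rw [hμR t hlt hR]
      nlinarith [mul_nonneg (Nat.cast_nonneg (α := ℝ) n) ha]
    · rw [hμn t hlt hR]
      have h1 : |u t - μ t| ≤ n * a := by
        refine ih hlt.le ?_
        rcases h with h | ⟨b, hb, s, hs, hRs⟩
        · exact Or.inl (by omega)
        · have : t = b + n := by omega
          refine Or.inr ⟨b, this, s, ?_, hRs⟩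
          rcases Nat.lt_succ_iff_lt_or_eq.1 hs with h' | h'
          · exact h'
          · subst h'; exact absurd (this ▸ hRs) hR
      have h2 := abs_sub_le (u (t + 1)) (u t) (μ t)
      linarith

end Regret

/-! ### Stochastic subgradient descent -/

section Descent

variable {Ω : Type*} {mΩ : MeasurableSpace Ω} {P : Measure Ω} [IsProbabilityMeasure P]
  {ℱ : Filtration ℕ mΩ} {d m : ℕ}

/-- The deterministic data of the problem: constraint set, convexity, Lipschitz continuity of the
constraints, diameter, and bounded subgradient oracles. -/
structure ConvexData (W : Set (E d)) (g : Fin m → E d → ℝ) (dg : Fin m → E d → E d)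
    (Lg : ℝ≥0) (D Gf Gg γ : ℝ) : Prop where
  convex : Convex ℝ W
  isClosed : IsClosed W
  lipschitz : ∀ i, LipschitzOnWith Lg (g i) W
  diam : ∀ w ∈ W, ∀ w' ∈ W, ‖w - w'‖ ≤ D
  measurable_grad : ∀ i, Measurable (dg i)
  grad_mem : ∀ i, ∀ w ∈ W, dg i w ∈ subdifferential W (fun x => max 0 (g i x)) w
  norm_grad_le : ∀ i, ∀ w ∈ W, ‖dg i w‖ ≤ Gg
  γ_pos : 0 < γ
  Gf_nonneg : 0 ≤ Gf
  Gg_nonneg : 0 ≤ Gg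
  D_pos : 1 ≤ D

lemma measurable_select {α β ι : Type*} {mα : MeasurableSpace α} [MeasurableSpace β] [Countable ι]
    {i : α → ι} (hi : ∀ j, MeasurableSet {a | i a = j}) {F : ι → α → β}
    (hF : ∀ j, Measurable (F j)) : Measurable fun a => F (i a) a := by
  intro s hs
  have : (fun a => F (i a) a) ⁻¹' s = ⋃ j, {a | i a = j} ∩ F j ⁻¹' s := by
    ext a; simp
  rw [this]
  exact MeasurableSet.iUnion fun j => (hi j).inter (hF j hs)

/-- The sign is mean minus realization: the conditional means, which dominate the objective gaps,
are to be bounded above by the realized linearizations. -/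
lemma martingaleDifferences_condExp_sub {T : ℕ} {A : ℕ → Ω → ℝ}
    (hA : ∀ t < T, StronglyMeasurable[ℱ (t + 1)] (A t)) {b : ℝ}
    (hb : ∀ t < T, ∀ᵐ ω ∂P, |A t ω| ≤ b) :
    MartingaleDifferences P ℱ T fun t => P[A t | ℱ t] - A t where
  adapted t ht := (stronglyMeasurable_condExp.mono (ℱ.mono (Nat.le_succ t))).sub (hA t ht)
  condExp_eq_zero t ht := by
    have hi : Integrable (A t) P :=
      integrable_of_ae_bound ((hA t ht).mono (ℱ.le _)).aestronglyMeasurable (hb t ht)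
    have h1 := condExp_sub (integrable_condExp (m := ℱ t) (f := A t)) hi (ℱ t)
    rw [condExp_of_stronglyMeasurable (ℱ.le t) stronglyMeasurable_condExp integrable_condExp,
      sub_self] at h1
    exact h1

omit [IsProbabilityMeasure P] in
lemma abs_condExp_sub_le {𝒢 : MeasurableSpace Ω} {A : Ω → ℝ} {b : ℝ}
    (hb : ∀ᵐ ω ∂P, |A ω| ≤ b) : ∀ᵐ ω ∂P, |(P[A | 𝒢] - A) ω| ≤ 2 * b := by
  filter_upwards [ae_bdd_abs_condExp_of_ae_bdd_abs (m := 𝒢) hb, hb] with ω h1 h2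
  rw [Pi.sub_apply]
  linarith [abs_sub ((P[A | 𝒢]) ω) (A ω)]

variable {W : Set (E d)} {f : E d → ℝ} {g : Fin m → E d → ℝ} {dg : Fin m → E d → E d}
  {Lg : ℝ≥0} {D Gf Gg γ : ℝ}

/-- A high-probability bound for projected stochastic subgradient descent on
`f + γ ∑_j p_j max(0, g_j)`, where the index `i t` of the constraint used in step `t` is drawn from
`p t`. -/
lemma measureReal_descent_le (hd : ConvexData W g dg Lg D Gf Gg γ) {T : ℕ} (hT : 0 < T)
    {w ξ : ℕ → Ω → E d} {i : ℕ → Ω → Fin m} {p : ℕ → Ω → Fin m → ℝ} {η b L : ℝ} (hη : 0 < η)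
    (hL : 0 ≤ L) (hb0 : 0 < b) (hb : 2 * ((Gf + γ * Gg) * D) ≤ b)
    (hwm : ∀ t < T, Measurable[ℱ t] (w t)) (hwW : ∀ t ω, w t ω ∈ W)
    (hξ : StochasticSubgradients P ℱ W f Gf T w ξ)
    (hi : ∀ t < T, ∀ j, MeasurableSet[ℱ (t + 1)] {ω | i t ω = j})
    (hp : ∀ t < T, ∀ j, P[Set.indicator {ω | i t ω = j} (fun _ => (1 : ℝ)) | ℱ t] =ᵐ[P]
      fun ω => p t ω j)
    (hp0 : ∀ t ω j, 0 ≤ p t ω j)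
    (hw : ∀ t ω, w (t + 1) ω = proj W (w t ω - η • (ξ t ω + γ • dg (i t ω) (w t ω))))
    {u : E d} (hu : u ∈ feasible W g) :
    P.real {ω | ¬ (∑ t ∈ Finset.range T,
        (f (w t ω) + γ * ∑ j, p t ω j * max 0 (g j (w t ω)) - f u) ≤
      D ^ 2 / (2 * η) + η * T * (Gf + γ * Gg) ^ 2 / 2 + b * Real.sqrt (2 * T * L))} ≤
      Real.exp (-L) := by
  have hγ := hd.γ_pos
  set A : ℕ → Ω → ℝ := fun t ω =>
    inner ℝ (ξ t ω + γ • dg (i t ω) (w t ω)) (w t ω - u) with hA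
  have hΔ : ∀ t < T, ∀ᵐ ω ∂P, ‖ξ t ω + γ • dg (i t ω) (w t ω)‖ ≤ Gf + γ * Gg := by
    intro t ht
    filter_upwards [hξ.bounded t ht] with ω hω
    refine (norm_add_le _ _).trans (add_le_add hω ?_)
    rw [norm_smul, Real.norm_eq_abs, abs_of_pos hγ]
    exact mul_le_mul_of_nonneg_left (hd.norm_grad_le _ _ (hwW t ω)) hγ.le
  have hAm : ∀ t < T, StronglyMeasurable[ℱ (t + 1)] (A t) := by
    intro t ht
    have h1 : Measurable[ℱ (t + 1)] (w t) := (hwm t ht).mono (ℱ.mono (Nat.le_succ t)) le_rfl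
    have h2 : Measurable[ℱ (t + 1)] fun ω => dg (i t ω) (w t ω) :=
      measurable_select (F := fun j ω => dg j (w t ω)) (hi t ht)
        fun j => (hd.measurable_grad j).comp h1
    exact (((hξ.adapted t ht).add (h2.const_smul γ).stronglyMeasurable).inner
      (h1.sub_const u).stronglyMeasurable)
  have hG : 0 ≤ Gf + γ * Gg := add_nonneg hd.Gf_nonneg (mul_nonneg hγ.le hd.Gg_nonneg)
  have hAb : ∀ t < T, ∀ᵐ ω ∂P, |A t ω| ≤ (Gf + γ * Gg) * D := by
    intro t ht
    filter_upwards [hΔ t ht] with ω hω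
    refine (abs_real_inner_le_norm _ _).trans ?_
    exact mul_le_mul hω (hd.diam _ (hwW t ω) _ hu.1) (norm_nonneg _) hG
  -- Centring doubles the bound on `A`, which accounts for the factor 2 in `hb`.
  have haz := measureReal_sum_ge_le hT (martingaleDifferences_condExp_sub hAm hAb) hb0
    (fun t ht => (abs_condExp_sub_le (hAb t ht)).mono fun ω hω => hω.trans hb) hL
  -- the conditional mean of the linearization
  have hmean : ∀ t < T, ∀ᵐ ω ∂P,
      f (w t ω) + γ * ∑ j, p t ω j * max 0 (g j (w t ω)) - f u ≤ (P[A t | ℱ t]) ω := by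
    intro t ht
    have hv : StronglyMeasurable[ℱ t] fun ω => w t ω - u := ((hwm t ht).sub_const u).stronglyMeasurable
    have hvb : ∀ᵐ ω ∂P, ‖w t ω - u‖ ≤ D := ae_of_all _ fun ω => hd.diam _ (hwW t ω) _ hu.1
    have hξi : Integrable (ξ t) P := integrable_of_ae_bound
      ((hξ.adapted t ht).mono (ℱ.le _)).aestronglyMeasurable (hξ.bounded t ht)
    set J : Fin m → Ω → ℝ := fun j => Set.indicator {ω | i t ω = j} (fun _ => (1 : ℝ)) with hJ
    have hJi : ∀ j, Integrable (J j) P := fun j =>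
      (integrable_const _).indicator (ℱ.le _ _ (hi t ht j))
    set Z : Fin m → Ω → ℝ := fun j ω => inner ℝ (dg j (w t ω)) (w t ω - u) with hZ
    have hZm : ∀ j, StronglyMeasurable[ℱ t] (Z j) := fun j =>
      ((hd.measurable_grad j).comp (hwm t ht)).stronglyMeasurable.inner hv
    have hZb : ∀ j, ∀ᵐ ω ∂P, ‖Z j ω‖ ≤ Gg * D := fun j => ae_of_all _ fun ω =>
      (norm_inner_le_norm _ _).trans (mul_le_mul (hd.norm_grad_le _ _ (hwW t ω))
        (hd.diam _ (hwW t ω) _ hu.1) (norm_nonneg _) hd.Gg_nonneg)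
    -- The index `i t` is not known at time `t`; decomposing over its values leaves `ℱ t`-measurable
    -- factors `Z j` times indicators whose conditional means are `p t j`.
    have hsplit : A t = (fun ω => (innerSL ℝ (w t ω - u)) (ξ t ω)) + γ • ∑ j, Z j * J j := by
      ext ω
      simp only [hA, Pi.add_apply, Pi.smul_apply, Finset.sum_apply, Pi.mul_apply, innerSL_apply_apply,
        smul_eq_mul, inner_add_left, real_inner_smul_left]
      congr 1
      · exact real_inner_comm _ _
      · rw [Finset.sum_eq_single (i t ω)]
        · simp [hZ, hJ]
        · intro j _ hj
          simp [hJ, Set.indicator_of_notMem, Ne.symm hj]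
        · simp
    have hi1 : Integrable (fun ω => (innerSL ℝ (w t ω - u)) (ξ t ω)) P := by
      refine integrable_of_ae_bound (C := D * Gf) ?_ ?_
      · exact ((hv.mono (ℱ.le t)).inner ((hξ.adapted t ht).mono (ℱ.le _))).aestronglyMeasurable
      · filter_upwards [hvb, hξ.bounded t ht] with ω h1 h2
        exact (norm_inner_le_norm _ _).trans (mul_le_mul h1 h2 (norm_nonneg _)
          (by linarith [hd.D_pos]))
    have hi2 : ∀ j, Integrable (Z j * J j) P := fun j =>
      (hJi j).bdd_mul ((hZm j).mono (ℱ.le t)).aestronglyMeasurable (hZb j)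
    have h1 := condExp_stronglyMeasurable_bilin_of_bound (innerSL ℝ) (ℱ.le t) hv hξi D hvb
    have h2 : ∀ j, P[Z j * J j | ℱ t] =ᵐ[P] Z j * P[J j | ℱ t] := fun j =>
      condExp_stronglyMeasurable_mul_of_bound (ℱ.le t) (hZm j) (hJi j) _ (hZb j)
    have h3 := condExp_finsetSum (μ := P) (s := Finset.univ) (f := fun j => Z j * J j)
      (fun j _ => hi2 j) (ℱ t)
    have h4 := condExp_smul (μ := P) γ (∑ j, Z j * J j) (ℱ t)
    have h5 := condExp_add hi1 ((integrable_finsetSum' Finset.univ fun j _ => hi2 j).smul γ) (ℱ t)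
    rw [hsplit]
    filter_upwards [h1, ae_all_iff.2 h2, h3, h4, h5, hξ.unbiased t ht, ae_all_iff.2 (hp t ht)]
      with ω e1 e2 e3 e4 e5 hsub hpω
    rw [e5, Pi.add_apply, e1, e4, Pi.smul_apply, e3, Finset.sum_apply, innerSL_apply_apply]
    have h6 := hsub u hu.1
    have h7 : inner ℝ ((P[ξ t | ℱ t]) ω) (u - w t ω) =
        - inner ℝ (w t ω - u) ((P[ξ t | ℱ t]) ω) := by
      rw [← neg_sub, inner_neg_right, real_inner_comm]
    have h8 : ∑ j, p t ω j * max 0 (g j (w t ω)) ≤ ∑ j, (P[Z j * J j | ℱ t]) ω := by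
      refine Finset.sum_le_sum fun j _ => ?_
      rw [e2 j, Pi.mul_apply, hpω j, mul_comm]
      refine mul_le_mul_of_nonneg_right ?_ (hp0 t ω j)
      -- At the feasible point `u` the positive parts vanish, so the subgradient inequality bounds
      -- `max 0 (g j (w t))` by the linearization.
      have h9 := hd.grad_mem j _ (hwW t ω) u hu.1
      simp only [max_eq_left (hu.2 j)] at h9
      rw [← neg_sub, inner_neg_right] at h9
      linarith
    have h10 := mul_le_mul_of_nonneg_left h8 hγ.le
    rw [smul_eq_mul]
    linarith
  refine le_trans (ENNReal.toReal_mono (measure_ne_top _ _) (measure_mono_ae ?_)) haz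
  have hall : ∀ᵐ ω ∂P, ∀ t < T, ‖ξ t ω + γ • dg (i t ω) (w t ω)‖ ≤ Gf + γ * Gg ∧
      f (w t ω) + γ * ∑ j, p t ω j * max 0 (g j (w t ω)) - f u ≤ (P[A t | ℱ t]) ω := by
    rw [ae_all_iff]
    intro t
    by_cases ht : t < T
    · filter_upwards [hΔ t ht, hmean t ht] with ω h1 h2 _ using ⟨h1, h2⟩
    · exact ae_of_all _ fun ω h => absurd h ht
  filter_upwards [hall] with ω hω hbad
  by_contra hlt
  refine hbad ?_
  have hreg := sum_inner_le hd.convex hd.isClosed hd.diam hη (T := T) (w := fun t => w t ω)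
    (Δ := fun t => ξ t ω + γ • dg (i t ω) (w t ω)) (hwW 0 ω) (fun t _ => hw t ω)
    (fun t ht => (hω t ht).1) hu.1
  have h1 := Finset.sum_le_sum fun t (ht : t ∈ Finset.range T) => (hω t (Finset.mem_range.1 ht)).2
  have h2 : ∑ t ∈ Finset.range T, (P[A t | ℱ t] - A t) ω < b * Real.sqrt (2 * T * L) :=
    lt_of_not_ge hlt
  simp only [Pi.sub_apply, Finset.sum_sub_distrib] at h2
  linarith

end Descent

/-! ### The run of LightTouch -/

section LightRun

variable {Ω : Type*} {d m : ℕ} {W : Set (E d)} {g : Fin m → E d → ℝ} {dg : Fin m → E d → E d}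
  {γ η : ℝ} {k : ℕ} {w₁ : Ω → E d} {ξ : ℕ → Ω → E d} {i : ℕ → Ω → Fin m}
  {S : ℕ → Ω → Finset (Fin m)}

/-- The random state of LightTouch after `t` iterations. -/
noncomputable def lightState (W : Set (E d)) (g : Fin m → E d → ℝ) (dg : Fin m → E d → E d) (γ η : ℝ)
    (k : ℕ) (w₁ : Ω → E d) (ξ : ℕ → Ω → E d) (i : ℕ → Ω → Fin m) (S : ℕ → Ω → Finset (Fin m))
    (t : ℕ) (ω : Ω) : State d m :=
  (lightIter W g dg γ η k (w₁ ω) (fun s => ξ s ω) (fun s => i s ω) (fun s => S s ω) t).val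

/-- The stochastic supergradient at a state, for a minibatch `A`. -/
noncomputable def gain (g : Fin m → E d → ℝ) (γ : ℝ) (k : ℕ) (s : State d m) (A : Finset (Fin m)) :
    Fin m → ℝ :=
  fun j => γ * s.μ j + γ * m / k * (if j ∈ A then max 0 (g j s.w) - s.μ j else 0)

local notation "st" => lightState W g dg γ η k w₁ ξ i S

lemma lightState_zero (ω : Ω) : st 0 ω =
    { w := w₁ ω, p := fun _ => 1 / (m : ℝ), μ := fun j => max 0 (g j (w₁ ω)) } := by
  have : st 0 ω =
    { w := w₁ ω
      p := fun _ => 1 / (m : ℝ)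
      μ := fun j => max 0 (if j ∈ Finset.univ then g j (w₁ ω) else 0) } := rfl
  simpa using this

lemma lightState_succ (t : ℕ) (ω : Ω) : st (t + 1) ω =
    { w := proj W ((st t ω).w - η • (ξ t ω + γ • dg (i t ω) (st t ω).w))
      p := multUpdate η (st t ω).p (gain g γ k (st t ω) (S t ω))
      μ := fun j => if j ∈ S t ω then max 0 (g j (st t ω).w) else (st t ω).μ j } := by
  -- `forEach` records `0` outside the minibatch; these entries are never read, so the true
  -- constraint values may replace them.
  have : st (t + 1) ω =
    { w := proj W ((st t ω).w - η • (ξ t ω + γ • dg (i t ω) (st t ω).w))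
      p := multUpdate η (st t ω).p (supergradient γ k (S t ω)
        (fun j => if j ∈ S t ω then g j (st t ω).w else 0) (st t ω).μ)
      μ := fun j => if j ∈ S t ω then max 0 (if j ∈ S t ω then g j (st t ω).w else 0)
        else (st t ω).μ j } := rfl
  rw [this]
  congr 1
  · congr 1
    funext j
    unfold supergradient gain
    by_cases hj : j ∈ S t ω <;> simp [hj]
  · funext j
    by_cases hj : j ∈ S t ω <;> simp [hj]

lemma lightState_checks (t T : ℕ) (ht : t ≤ T) (ω : Ω) (hS : ∀ s < T, (S s ω).card = k) :
    (lightIter W g dg γ η k (w₁ ω) (fun s => ξ s ω) (fun s => i s ω) (fun s => S s ω) t).checks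
      = m + t * (1 + k) := by
  induction t with
  | zero =>
    have : (lightIter W g dg γ η k (w₁ ω) (fun s => ξ s ω) (fun s => i s ω)
      (fun s => S s ω) 0).checks = (∑ _j : Fin m, 1) + 0 := rfl
    simp [this]
  | succ t ih =>
    have : (lightIter W g dg γ η k (w₁ ω) (fun s => ξ s ω) (fun s => i s ω)
        (fun s => S s ω) (t + 1)).checks =
      (lightIter W g dg γ η k (w₁ ω) (fun s => ξ s ω) (fun s => i s ω)
        (fun s => S s ω) t).checks + (1 + ((∑ _j ∈ S t ω, 1) + 0)) := rfl
    rw [this, ih (by omega)]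
    simp only [Finset.sum_const, smul_eq_mul, mul_one, hS t (by omega)]
    ring

lemma lightState_w_mem (hW : IsClosed W) (h1 : ∀ ω, w₁ ω ∈ W) (t : ℕ) (ω : Ω) :
    (st t ω).w ∈ W := by
  cases t with
  | zero => rw [lightState_zero]; exact h1 ω
  | succ t => rw [lightState_succ]; exact proj_mem hW ⟨_, h1 ω⟩ _

lemma lightState_p_nonneg [NeZero m] (t : ℕ) (ω : Ω) (j : Fin m) : 0 ≤ (st t ω).p j := by
  cases t with
  | zero => rw [lightState_zero]; positivity
  | succ t => rw [lightState_succ]; exact (multUpdate_pos _ _ _ _).le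

lemma sum_lightState_p [NeZero m] (t : ℕ) (ω : Ω) : ∑ j, (st t ω).p j = 1 := by
  cases t with
  | zero => rw [lightState_zero]; simp [NeZero.ne m]
  | succ t => rw [lightState_succ]; exact sum_multUpdate _ _ _

lemma abs_max_zero_sub_le {Lg : ℝ≥0} {φ : E d → ℝ} (h : LipschitzOnWith Lg φ W) {x y : E d}
    (hx : x ∈ W) (hy : y ∈ W) : |max 0 (φ x) - max 0 (φ y)| ≤ Lg * ‖x - y‖ := by
  rw [max_comm 0, max_comm 0]
  refine (abs_max_sub_max_le_abs _ _ _).trans ?_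
  simpa [dist_eq_norm, Real.dist_eq] using h.dist_le_mul x hx y hy

/-- Positive parts vanish at the feasible point `u`, within distance `D`. This gives the scale `γ Lg
D` of the gains. -/
lemma max_zero_le {Lg : ℝ≥0} {D Gf Gg : ℝ} (hd : ConvexData W g dg Lg D Gf Gg γ) {x u : E d}
    (hx : x ∈ W) (hu : u ∈ feasible W g) (j : Fin m) : max 0 (g j x) ≤ Lg * D := by
  have h := abs_max_zero_sub_le (hd.lipschitz j) hx hu.1
  rw [max_eq_left (hu.2 j), sub_zero] at h
  exact (le_abs_self _).trans (h.trans
    (mul_le_mul_of_nonneg_left (hd.diam _ hx _ hu.1) Lg.coe_nonneg))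

lemma lightState_μ_mem {Lg : ℝ≥0} {D Gf Gg : ℝ} (hd : ConvexData W g dg Lg D Gf Gg γ) {u : E d}
    (hu : u ∈ feasible W g) (h1 : ∀ ω, w₁ ω ∈ W) (t : ℕ) (ω : Ω) (j : Fin m) :
    0 ≤ (st t ω).μ j ∧ (st t ω).μ j ≤ Lg * D := by
  induction t with
  | zero =>
    rw [lightState_zero]
    exact ⟨le_max_left _ _, max_zero_le hd (h1 ω) hu j⟩
  | succ t ih =>
    rw [lightState_succ]
    dsimp only
    split_ifs
    · exact ⟨le_max_left _ _, max_zero_le hd (lightState_w_mem hd.isClosed h1 t ω) hu j⟩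
    · exact ih

/-- The remembered part contributes at most `γ Lg D` for any batch; only the correction is magnified
by `m / k`, and `b` bounds it. -/
lemma abs_gain_le {Lg : ℝ≥0} {D Gf Gg : ℝ} (hd : ConvexData W g dg Lg D Gf Gg γ) {u : E d}
    (hu : u ∈ feasible W g) (h1 : ∀ ω, w₁ ω ∈ W) (t : ℕ) (ω : Ω) (j : Fin m) {b : ℝ}
    (hb : γ * m / k * |max 0 (g j (st t ω).w) - (st t ω).μ j| ≤ b) (A : Finset (Fin m)) :
    |gain g γ k (st t ω) A j| ≤ γ * Lg * D + b := by
  have hγ := hd.γ_pos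
  have hμ := lightState_μ_mem (k := k) (η := η) (ξ := ξ) (i := i) (S := S) hd hu h1 t ω j
  unfold gain
  refine (abs_add_le _ _).trans (add_le_add ?_ ?_)
  · rw [abs_of_nonneg (mul_nonneg hγ.le hμ.1), mul_assoc]
    exact mul_le_mul_of_nonneg_left hμ.2 hγ.le
  · have h0 : 0 ≤ γ * m / k := by positivity
    rw [abs_mul, abs_of_nonneg h0]
    split_ifs
    · exact hb
    · rw [abs_zero, mul_zero]
      exact (mul_nonneg h0 (abs_nonneg _)).trans hb

/-- The remembered constraint values are accurate where they have been refreshed recently. -/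
lemma abs_max_zero_sub_lightState_μ_le {Lg : ℝ≥0} {D Gf Gg : ℝ}
    (hd : ConvexData W g dg Lg D Gf Gg γ) (h1 : ∀ ω, w₁ ω ∈ W) (hη : 0 ≤ η) {T : ℕ} {ω : Ω}
    (hξ : ∀ t < T, ‖ξ t ω‖ ≤ Gf) {t n : ℕ} (ht : t ≤ T) (j : Fin m)
    (h : t ≤ n ∨ ∃ b, t = b + n ∧ ∃ s < n, j ∈ S (b + s) ω) :
    |max 0 (g j (st t ω).w) - (st t ω).μ j| ≤ n * (Lg * (η * (Gf + γ * Gg))) := by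
  have hW := lightState_w_mem (g := g) (dg := dg) (γ := γ) (η := η) (k := k) (ξ := ξ) (i := i)
    (S := S) hd.isClosed h1
  have hG : 0 ≤ Gf + γ * Gg :=
    add_nonneg hd.Gf_nonneg (mul_nonneg hd.γ_pos.le hd.Gg_nonneg)
  refine abs_sub_le_of_refreshed (u := fun t => max 0 (g j (st t ω).w))
    (μ := fun t => (st t ω).μ j) (R := fun t => j ∈ S t ω) (T := T) (by positivity) ?_ ?_ ?_ ?_ ht h
  · intro t ht
    refine (abs_max_zero_sub_le (hd.lipschitz j) (hW _ ω) (hW _ ω)).trans ?_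
    refine mul_le_mul_of_nonneg_left ?_ Lg.coe_nonneg
    rw [lightState_succ]
    refine norm_proj_step_sub_le hd.convex hd.isClosed hη (hW t ω) ?_
    refine (norm_add_le _ _).trans (add_le_add (hξ t ht) ?_)
    rw [norm_smul, Real.norm_eq_abs, abs_of_pos hd.γ_pos]
    exact mul_le_mul_of_nonneg_left (hd.norm_grad_le _ _ (hW t ω)) hd.γ_pos.le
  · simp only [lightState_zero]
  · intro t _ hR
    simp only [lightState_succ, if_pos hR]
  · intro t _ hR
    simp only [lightState_succ, if_neg hR]

end LightRun

/-! ### Measurability -/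

section Measurability

variable {Ω : Type*} {d m : ℕ} {W : Set (E d)} {g : Fin m → E d → ℝ} {dg : Fin m → E d → E d}
  {γ : ℝ}

/-- `g j` is controlled only on `W`; off `W` it may be arbitrary. A Lipschitz extension agrees with
it along `w`. -/
lemma ConvexData.measurable_comp {Lg : ℝ≥0} {D Gf Gg : ℝ}
    (hd : ConvexData W g dg Lg D Gf Gg γ) {mΩ : MeasurableSpace Ω} {w : Ω → E d}
    (hw : Measurable w) (hW : ∀ ω, w ω ∈ W) (j : Fin m) : Measurable fun ω => g j (w ω) := by
  obtain ⟨g', hg', he⟩ := (hd.lipschitz j).extend_real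
  have : (fun ω => g j (w ω)) = fun ω => g' (w ω) := funext fun ω => he (hW ω)
  rw [this]
  exact hg'.continuous.measurable.comp hw

lemma measurableSet_mem_of_forall_eq {mΩ : MeasurableSpace Ω} {S : Ω → Finset (Fin m)}
    (hS : ∀ A, MeasurableSet {ω | S ω = A}) (j : Fin m) : MeasurableSet {ω | j ∈ S ω} := by
  have : {ω | j ∈ S ω} = ⋃ A : {A : Finset (Fin m) // j ∈ A}, {ω | S ω = A} := by
    ext ω; simp
  rw [this]
  exact MeasurableSet.iUnion fun A => hS A

lemma measurable_proj_step {Lg : ℝ≥0} {D Gf Gg : ℝ} (hd : ConvexData W g dg Lg D Gf Gg γ)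
    {mΩ : MeasurableSpace Ω} {w ξ : Ω → E d} {i : Ω → Fin m} (η : ℝ) (hne : W.Nonempty)
    (hw : Measurable w) (hξ : Measurable ξ) (hi : ∀ j, MeasurableSet {ω | i ω = j}) :
    Measurable fun ω => proj W (w ω - η • (ξ ω + γ • dg (i ω) (w ω))) := by
  have h2 : Measurable fun ω => dg (i ω) (w ω) :=
    measurable_select (F := fun j ω => dg j (w ω)) hi fun j => (hd.measurable_grad j).comp hw
  exact (continuous_proj hd.convex hd.isClosed hne).measurable.comp
    (hw.sub ((hξ.add (h2.const_smul γ)).const_smul η))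

lemma measurable_gain {Lg : ℝ≥0} {D Gf Gg : ℝ} (hd : ConvexData W g dg Lg D Gf Gg γ) (k : ℕ)
    {mΩ : MeasurableSpace Ω} {s : Ω → State d m} {A : Ω → Finset (Fin m)}
    (hw : Measurable fun ω => (s ω).w) (hW : ∀ ω, (s ω).w ∈ W)
    (hμ : ∀ j, Measurable fun ω => (s ω).μ j) (hA : ∀ B, MeasurableSet {ω | A ω = B}) (j : Fin m) :
    Measurable fun ω => gain g γ k (s ω) (A ω) j :=
  ((hμ j).const_mul γ).add (Measurable.const_mul (Measurable.ite
    (measurableSet_mem_of_forall_eq hA j)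
    ((measurable_const.max (hd.measurable_comp hw hW j)).sub (hμ j)) measurable_const) _)

lemma measurable_multUpdate (η : ℝ) {mΩ : MeasurableSpace Ω} {p x : Ω → Fin m → ℝ}
    (hp : ∀ j, Measurable fun ω => p ω j) (hx : ∀ j, Measurable fun ω => x ω j) (j : Fin m) :
    Measurable fun ω => multUpdate η (p ω) (x ω) j := by
  have h : ∀ j, Measurable fun ω => Real.exp (Real.log (p ω j) + η * x ω j) := fun j =>
    Real.measurable_exp.comp ((Real.measurable_log.comp (hp j)).add ((hx j).const_mul η))
  refine (h j).div ?_
  exact Finset.measurable_fun_sum _ fun l _ => continuous_abs.measurable.comp (h l)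

lemma measurable_lightState {mΩ : MeasurableSpace Ω} {P : Measure Ω} {ℱ : Filtration ℕ mΩ}
    {f : E d → ℝ} {Lg : ℝ≥0} {D Gf Gg : ℝ} (hd : ConvexData W g dg Lg D Gf Gg γ) {η : ℝ}
    {k T : ℕ} {w₁ : Ω → E d} {ξ : ℕ → Ω → E d} {i : ℕ → Ω → Fin m} {S : ℕ → Ω → Finset (Fin m)}
    (h : LightExecution P ℱ W f g dg Gf γ η k T w₁ ξ i S) {t : ℕ} (ht : t ≤ T) :
    Measurable[ℱ t] (fun ω => (lightState W g dg γ η k w₁ ξ i S t ω).w) ∧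
    (∀ j, Measurable[ℱ t] fun ω => (lightState W g dg γ η k w₁ ξ i S t ω).p j) ∧
    ∀ j, Measurable[ℱ t] fun ω => (lightState W g dg γ η k w₁ ξ i S t ω).μ j := by
  -- The projection step needs `W` nonempty, and an outcome supplies the point `w₁ ω₀`.
  rcases isEmpty_or_nonempty Ω with hΩ | ⟨⟨ω₀⟩⟩
  · exact ⟨@measurable_of_empty _ _ (ℱ t) _ _ _, fun j => @measurable_of_empty _ _ (ℱ t) _ _ _,
      fun j => @measurable_of_empty _ _ (ℱ t) _ _ _⟩
  induction t with
  | zero =>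
    simp only [lightState_zero]
    exact ⟨h.init_measurable.measurable, fun j => measurable_const, fun j =>
      measurable_const.max (hd.measurable_comp h.init_measurable.measurable h.init_mem j)⟩
  | succ t ih =>
    obtain ⟨hw, hp, hμ⟩ := ih (by omega)
    have hle : ℱ t ≤ ℱ (t + 1) := ℱ.mono (Nat.le_succ t)
    have hw' := hw.mono hle le_rfl
    have hp' := fun j => (hp j).mono hle le_rfl
    have hμ' := fun j => (hμ j).mono hle le_rfl
    have hW := lightState_w_mem (g := g) (dg := dg) (γ := γ) (η := η) (k := k) (ξ := ξ) (i := i)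
      (S := S) hd.isClosed h.init_mem t
    simp only [lightState_succ]
    refine ⟨measurable_proj_step hd η ⟨_, h.init_mem ω₀⟩ hw'
      (h.subgradients.adapted t ht).measurable (h.index_adapted t ht), ?_, fun j => ?_⟩
    · exact measurable_multUpdate η hp'
        (measurable_gain hd k hw' hW hμ' (h.batch_adapted t ht))
    · exact Measurable.ite (measurableSet_mem_of_forall_eq (h.batch_adapted t ht) j)
        (measurable_const.max (hd.measurable_comp hw' hW j)) (hμ' j)

end Measurability

/-! ### The weights of LightTouch -/

section Weights

variable {Ω : Type*} {mΩ : MeasurableSpace Ω} {P : Measure Ω} [IsProbabilityMeasure P]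
  {ℱ : Filtration ℕ mΩ} {d m : ℕ} [NeZero m] {W : Set (E d)} {f : E d → ℝ}
  {g : Fin m → E d → ℝ} {dg : Fin m → E d → E d}
  {Lg : ℝ≥0} {D Gf Gg γ η : ℝ} {k T : ℕ} {w₁ : Ω → E d} {ξ : ℕ → Ω → E d} {i : ℕ → Ω → Fin m}
  {S : ℕ → Ω → Finset (Fin m)}

/-- The probability that a uniform `k`-subset avoids a given index. -/
lemma choose_pred_div_choose (hk : k ≤ m) :
    ((m - 1).choose k : ℝ) / (m.choose k : ℝ) = 1 - k / m := by
  obtain ⟨n, rfl⟩ : ∃ n, m = n + 1 := ⟨m - 1, by have := NeZero.pos m; omega⟩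
  have h : ((n.choose k * (n + 1) : ℕ) : ℝ) = ((n + 1).choose k * (n + 1 - k) : ℕ) := by
    rw [Nat.choose_mul_succ_eq]
  have hc : (0 : ℝ) < ((n + 1).choose k : ℝ) := Nat.cast_pos.2 (Nat.choose_pos hk)
  have hn : (0 : ℝ) < ((n + 1 : ℕ) : ℝ) := by positivity
  rw [Nat.cast_mul, Nat.cast_mul, Nat.cast_sub hk] at h
  rw [Nat.add_sub_cancel, div_eq_iff hc.ne', one_sub_div hn.ne', div_mul_eq_mul_div,
    eq_div_iff hn.ne', h, mul_comm]

lemma condExp_notMem_batch (h : LightExecution P ℱ W f g dg Gf γ η k T w₁ ξ i S) (hk : k ≤ m)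
    {t : ℕ} (ht : t < T) (j : Fin m) :
    P[Set.indicator {ω | j ∉ S t ω} (fun _ => (1 : ℝ)) | ℱ t] =ᵐ[P] fun _ => 1 - (k : ℝ) / m := by
  set 𝒜 := Finset.powersetCard k (Finset.univ.erase j) with h𝒜
  set I : Finset (Fin m) → Ω → ℝ := fun A => Set.indicator {ω | S t ω = A} (fun _ => (1 : ℝ))
  have hsum : Set.indicator {ω | j ∉ S t ω} (fun _ => (1 : ℝ)) = ∑ A ∈ 𝒜, I A := by
    ext ω
    rw [Finset.sum_apply]
    by_cases hj : j ∈ S t ω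
    · rw [Set.indicator_of_notMem (by simpa using hj)]
      refine (Finset.sum_eq_zero fun A hA => Set.indicator_of_notMem ?_ _).symm
      rintro (rfl : S t ω = A)
      exact Finset.notMem_erase j _ ((Finset.mem_powersetCard.1 hA).1 hj)
    · rw [Set.indicator_of_mem (by exact hj), Finset.sum_eq_single (S t ω)]
      · exact (Set.indicator_of_mem (s := {ω' | S t ω' = S t ω}) rfl fun _ => (1 : ℝ)).symm
      · intro A _ hA
        exact Set.indicator_of_notMem (s := {ω | S t ω = A}) (fun e => hA e.symm) _
      · intro hn
        refine absurd (Finset.mem_powersetCard.2 ⟨?_, h.batch_card t ht ω⟩) hn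
        exact fun l hl => Finset.mem_erase.2 ⟨fun e => hj (e ▸ hl), Finset.mem_univ l⟩
  have hI : ∀ A ∈ 𝒜, Integrable (I A) P := fun A _ =>
    (integrable_const _).indicator (ℱ.le _ _ (h.batch_adapted t ht A))
  have h1 := condExp_finsetSum (μ := P) hI (ℱ t)
  have h2 : ∀ᵐ ω ∂P, ∀ A ∈ 𝒜, (P[I A | ℱ t]) ω = 1 / (m.choose k : ℝ) := by
    refine (Filter.eventually_all_finset 𝒜).2 fun A hA => ?_
    exact h.batch_law t ht A (Finset.mem_powersetCard.1 hA).2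
  rw [hsum]
  filter_upwards [h1, h2] with ω e1 e2
  rw [e1, Finset.sum_apply, Finset.sum_congr rfl e2, Finset.sum_const, h𝒜,
    Finset.card_powersetCard, Finset.card_erase_of_mem (Finset.mem_univ j), Finset.card_univ,
    Fintype.card_fin, nsmul_eq_mul, mul_one_div, choose_pred_div_choose hk]

/-- Some constraint is likely to be missed during `n` consecutive iterations only with small
probability. -/
lemma measureReal_missed_le (h : LightExecution P ℱ W f g dg Gf γ η k T w₁ ξ i S) (hk : k ≤ m)
    (n : ℕ) :
    P.real {ω | ∃ b, b + n < T ∧ ∃ j, ∀ s < n, j ∉ S (b + s) ω} ≤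
      T * m * (1 - (k : ℝ) / m) ^ n := by
  have hm : (0 : ℝ) < m := Nat.cast_pos.2 (NeZero.pos m)
  have hr : 0 ≤ 1 - (k : ℝ) / m := by
    rw [sub_nonneg, div_le_one hm]; exact_mod_cast hk
  set M : ℕ → Fin m → Set Ω := fun b j => {ω | b + n < T ∧ ∀ s < n, j ∉ S (b + s) ω}
  have hM : ∀ b j, P.real (M b j) ≤ (1 - (k : ℝ) / m) ^ n := by
    intro b j
    by_cases hb : b + n < T
    · rw [← (measureReal_forall_mem_eq_pow (P := P) (ℱ := ℱ) (T := T)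
        (B := fun t => {ω | j ∉ S t ω})
        (fun t ht => (measurableSet_mem_of_forall_eq (h.batch_adapted t ht) j).compl)
        (fun t ht => condExp_notMem_batch h hk ht j) hb.le).2]
      exact measureReal_mono fun ω hω => hω.2
    · have : M b j = ∅ := Set.eq_empty_of_forall_notMem fun ω hω => hb hω.1
      rw [this, measureReal_empty]
      positivity
  have hsub : {ω | ∃ b, b + n < T ∧ ∃ j, ∀ s < n, j ∉ S (b + s) ω} ⊆
      ⋃ x ∈ Finset.range T ×ˢ (Finset.univ : Finset (Fin m)), M x.1 x.2 := by
    rintro ω ⟨b, hb, j, hj⟩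
    refine Set.mem_biUnion (x := (b, j)) ?_ ⟨hb, hj⟩
    simp only [Finset.coe_product, Finset.coe_range, Finset.coe_univ, Set.mem_prod, Set.mem_Iio,
      Set.mem_univ, and_true]
    omega
  refine (measureReal_mono hsub (measure_ne_top _ _)).trans
    ((measureReal_biUnion_finset_le _ _).trans ?_)
  refine (Finset.sum_le_card_nsmul _ _ _ fun x _ => hM x.1 x.2).trans_eq ?_
  rw [Finset.card_product, Finset.card_range, Finset.card_univ, Fintype.card_fin, nsmul_eq_mul,
    Nat.cast_mul]

/-- The weight `m / k` is the inverse of the inclusion probability, which makes the supergradient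
unbiased. -/
lemma condExp_correction (h : LightExecution P ℱ W f g dg Gf γ η k T w₁ ξ i S) (hk0 : 0 < k)
    (hk : k ≤ m) {t : ℕ} (ht : t < T) (l : Fin m) :
    P[fun ω => 1 - (m : ℝ) / k * (if l ∈ S t ω then 1 else 0) | ℱ t] =ᵐ[P] 0 := by
  have hm : (0 : ℝ) < m := Nat.cast_pos.2 (NeZero.pos m)
  have hk' : (0 : ℝ) < k := Nat.cast_pos.2 hk0
  set J := Set.indicator {ω | l ∉ S t ω} (fun _ => (1 : ℝ)) with hJ
  have hJm : MeasurableSet {ω | l ∉ S t ω} :=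
    ℱ.le _ _ (measurableSet_mem_of_forall_eq (h.batch_adapted t ht) l).compl
  have hJi : Integrable J P := (integrable_const _).indicator hJm
  have he : (fun ω => 1 - (m : ℝ) / k * (if l ∈ S t ω then 1 else 0)) =
      (fun _ => 1 - (m : ℝ) / k) + ((m : ℝ) / k) • J := by
    ext ω
    by_cases hl : l ∈ S t ω <;> simp [hJ, hl, Set.indicator]
  rw [he]
  have h1 := condExp_add (integrable_const (1 - (m : ℝ) / k)) (hJi.smul ((m : ℝ) / k)) (ℱ t)
  have h2 := condExp_smul (μ := P) ((m : ℝ) / k) J (ℱ t)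
  filter_upwards [h1, h2, condExp_notMem_batch h hk ht l] with ω e1 e2 e3
  rw [e1, Pi.add_apply, e2, Pi.smul_apply, e3, condExp_const (ℱ.le t), smul_eq_mul,
    Pi.zero_apply]
  field_simp
  ring

omit [NeZero m] in
-- Keeps the noise of the regret at `2 b`, rather than a multiple of `m b`, when the errors are
-- paired with `e_j - p`.
lemma sum_abs_sub_le_two {p : Fin m → ℝ} (hp : ∀ l, 0 ≤ p l) (hp1 : ∑ l, p l = 1) (j : Fin m) :
    ∑ l, |(if l = j then 1 else 0) - p l| ≤ 2 := by
  calc ∑ l, |(if l = j then 1 else 0) - p l| ≤ ∑ l, ((if l = j then 1 else 0) + p l) :=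
        Finset.sum_le_sum fun l _ => by
          refine (abs_sub _ _).trans_eq ?_
          rw [abs_of_nonneg (hp l)]
          split_ifs <;> simp
    _ = 2 := by rw [Finset.sum_add_distrib, hp1]; norm_num

local notation "st" => lightState W g dg γ η k w₁ ξ i S

/-- A high-probability regret bound for the weights of LightTouch. -/
lemma measureReal_weights_le (hd : ConvexData W g dg Lg D Gf Gg γ) (hη : 0 < η)
    (h : LightExecution P ℱ W f g dg Gf γ η k T w₁ ξ i S) (hT : 0 < T) (hk0 : 0 < k) (hk : k ≤ m)
    {u : E d} (hu : u ∈ feasible W g) {n : ℕ} {b L : ℝ} (hb0 : 0 < b)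
    (hb : γ * m / k * (n * (Lg * (η * (Gf + γ * Gg)))) ≤ b) (hL : 0 ≤ L) :
    P.real {ω | ¬ ∀ j, ∑ t ∈ Finset.range T, γ * (max 0 (g j (st t ω).w) -
        ∑ l, (st t ω).p l * max 0 (g l (st t ω).w)) ≤
      Real.log m / η + 2 * η * T * (γ * Lg * D + b) ^ 2 + 2 * b * Real.sqrt (2 * T * L)} ≤
      m * Real.exp (-L) + T * m * (1 - (k : ℝ) / m) ^ n := by
  classical
  have hγ := hd.γ_pos
  have hm : (0 : ℝ) < m := Nat.cast_pos.2 (NeZero.pos m)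
  have hk' : (0 : ℝ) < k := Nat.cast_pos.2 hk0
  have hmk : 1 ≤ (m : ℝ) / k := by rw [one_le_div hk']; exact_mod_cast hk
  set φ : Fin m → ℕ → Ω → ℝ := fun l t ω => max 0 (g l (st t ω).w) with hφ
  set e : Fin m → ℕ → Ω → ℝ := fun l t ω => φ l t ω - (st t ω).μ l with he
  set V : Fin m → ℕ → Ω → ℝ := fun l t ω => 1 - (m : ℝ) / k * (if l ∈ S t ω then 1 else 0) with hV
  -- Staleness is small only with high probability, while Azuma needs almost sure bounds.
  -- Multiplying by the indicator of the `ℱ t`-measurable event `ok t` bounds `Y` everywhere and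
  -- keeps it a martingale difference; where no index is missed for long, nothing is changed.
  set ok : ℕ → Set Ω := fun t => {ω | ∀ l, γ * m / k * |e l t ω| ≤ b} with hok
  set F : Fin m → Fin m → ℕ → Ω → ℝ := fun j l t =>
    (ok t).indicator fun ω => ((if l = j then 1 else 0) - (st t ω).p l) * (γ * e l t ω) with hF
  set Y : Fin m → ℕ → Ω → ℝ := fun j t => ∑ l, F j l t * V l t with hY
  have hF1 : ∀ j l t, ∀ ω ∈ ok t, F j l t ω =
      ((if l = j then 1 else 0) - (st t ω).p l) * (γ * e l t ω) :=
    fun j l t ω hω => Set.indicator_of_mem hω _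
  have hF0 : ∀ j l t, ∀ ω ∉ ok t, F j l t ω = 0 := fun j l t ω hω =>
    Set.indicator_of_notMem hω _
  have hYs : ∀ j t ω, Y j t ω = ∑ l, F j l t ω * V l t ω := fun j t ω => by
    simp only [hY, Finset.sum_apply, Pi.mul_apply]
  have hWm := lightState_w_mem (g := g) (dg := dg) (γ := γ) (η := η) (k := k) (ξ := ξ) (i := i)
    (S := S) hd.isClosed h.init_mem
  have hVb : ∀ l t ω, |V l t ω| ≤ m / k := by
    intro l t ω
    rw [hV, abs_le]
    dsimp only
    split_ifs <;> constructor <;> linarith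
  have hpsub : ∀ j l t ω, |(if l = j then 1 else 0) - (st t ω).p l| ≤ 2 := fun j l t ω =>
    (Finset.single_le_sum (f := fun l => |(if l = j then 1 else 0) - (st t ω).p l|)
      (fun l _ => abs_nonneg _) (Finset.mem_univ l)).trans
      (sum_abs_sub_le_two (lightState_p_nonneg t ω) (sum_lightState_p t ω) j)
  have hγe : ∀ t, ∀ ω ∈ ok t, ∀ l, |γ * e l t ω| * (m / k) ≤ b := by
    intro t ω hω l
    refine le_trans (le_of_eq ?_) (hω l)
    rw [abs_mul, abs_of_pos hγ]; ring
  have hFb : ∀ j l t ω, |F j l t ω| ≤ 2 * b := by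
    intro j l t ω
    by_cases hω : ω ∈ ok t
    · rw [hF1 j l t ω hω, abs_mul]
      refine mul_le_mul (hpsub j l t ω) ?_ (abs_nonneg _) (by norm_num)
      exact (le_mul_of_one_le_right (abs_nonneg _) hmk).trans (hγe t ω hω l)
    · rw [hF0 j l t ω hω, abs_zero]; positivity
  have hYb : ∀ j t ω, |Y j t ω| ≤ 2 * b := by
    intro j t ω
    rw [hYs]
    by_cases hω : ω ∈ ok t
    · calc |∑ l, F j l t ω * V l t ω|
          ≤ ∑ l, |F j l t ω * V l t ω| := Finset.abs_sum_le_sum_abs _ _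
        _ ≤ ∑ l, |(if l = j then 1 else 0) - (st t ω).p l| * b := by
            refine Finset.sum_le_sum fun l _ => ?_
            rw [hF1 j l t ω hω, abs_mul, abs_mul, mul_assoc]
            refine mul_le_mul_of_nonneg_left ?_ (abs_nonneg _)
            exact (mul_le_mul_of_nonneg_left (hVb l t ω) (abs_nonneg _)).trans (hγe t ω hω l)
        _ ≤ 2 * b := by
            rw [← Finset.sum_mul]
            exact mul_le_mul_of_nonneg_right
              (sum_abs_sub_le_two (lightState_p_nonneg t ω) (sum_lightState_p t ω) j) hb0.le
    · simp only [hF0 j _ t ω hω, zero_mul, Finset.sum_const_zero, abs_zero]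
      positivity
  have hem : ∀ t < T, ∀ l, Measurable[ℱ t] (e l t) := by
    intro t ht l
    obtain ⟨h1, -, h3⟩ := measurable_lightState hd h ht.le
    exact (measurable_const.max (hd.measurable_comp h1 (hWm t) l)).sub (h3 l)
  have hFm : ∀ t < T, ∀ j l, StronglyMeasurable[ℱ t] (F j l t) := by
    intro t ht j l
    obtain ⟨-, h2, -⟩ := measurable_lightState hd h ht.le
    have hokm : MeasurableSet[ℱ t] (ok t) := by
      have : ok t = ⋂ l, {ω | γ * m / k * |e l t ω| ≤ b} := by ext ω; simp [hok]
      rw [this]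
      refine MeasurableSet.iInter fun l => ?_
      exact measurableSet_le ((continuous_abs.measurable.comp (hem t ht l)).const_mul _)
        measurable_const
    exact (((measurable_const.sub (h2 l)).mul ((hem t ht l).const_mul γ)).indicator
      hokm).stronglyMeasurable
  have hVm : ∀ t < T, ∀ l, StronglyMeasurable[ℱ (t + 1)] (V l t) := by
    intro t ht l
    exact (measurable_const.sub (Measurable.const_mul (Measurable.ite
      (measurableSet_mem_of_forall_eq (h.batch_adapted t ht) l) measurable_const
      measurable_const) _)).stronglyMeasurable
  have hYmart : ∀ j, MartingaleDifferences P ℱ T (Y j) := by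
    intro j
    have hVi : ∀ t < T, ∀ l, Integrable (V l t) P := fun t ht l =>
      integrable_of_ae_bound ((hVm t ht l).mono (ℱ.le _)).aestronglyMeasurable
        (ae_of_all _ fun ω => hVb l t ω)
    refine ⟨fun t ht => ?_, fun t ht => ?_⟩
    · exact Finset.stronglyMeasurable_sum _ fun l _ =>
        ((hFm t ht j l).mono (ℱ.mono (Nat.le_succ t))).mul (hVm t ht l)
    · have hi : ∀ l, Integrable (F j l t * V l t) P := fun l =>
        (hVi t ht l).bdd_mul ((hFm t ht j l).mono (ℱ.le t)).aestronglyMeasurable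
          (ae_of_all _ fun ω => hFb j l t ω)
      have h1 := condExp_finsetSum (μ := P) (s := Finset.univ) (f := fun l => F j l t * V l t)
        (fun l _ => hi l) (ℱ t)
      have h2 := fun l => condExp_stronglyMeasurable_mul_of_bound (ℱ.le t) (hFm t ht j l)
        (hVi t ht l) _ (ae_of_all P fun ω => hFb j l t ω)
      filter_upwards [h1, ae_all_iff.2 h2,
        ae_all_iff.2 fun l => condExp_correction h hk0 hk ht l] with ω e1 e2 e3
      rw [hY, e1, Finset.sum_apply, Pi.zero_apply]
      refine Finset.sum_eq_zero fun l _ => ?_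
      rw [e2 l, Pi.mul_apply, e3 l, Pi.zero_apply, mul_zero]
  have haz : ∀ j, P.real {ω | 2 * b * Real.sqrt (2 * T * L) ≤ ∑ t ∈ Finset.range T, Y j t ω} ≤
      Real.exp (-L) := fun j =>
    measureReal_sum_ge_le hT (hYmart j) (by positivity)
      (fun t _ => ae_of_all _ fun ω => hYb j t ω) hL
  have hunion : P.real ((⋃ j, {ω | 2 * b * Real.sqrt (2 * T * L) ≤
      ∑ t ∈ Finset.range T, Y j t ω}) ∪ {ω | ∃ b, b + n < T ∧ ∃ j, ∀ s < n, j ∉ S (b + s) ω}) ≤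
      m * Real.exp (-L) + T * m * (1 - (k : ℝ) / m) ^ n := by
    refine (measureReal_union_le _ _).trans (add_le_add ?_ (measureReal_missed_le h hk n))
    refine (measureReal_iUnion_fintype_le _).trans ?_
    refine (Finset.sum_le_card_nsmul _ _ _ fun j _ => haz j).trans_eq ?_
    rw [Finset.card_univ, Fintype.card_fin, nsmul_eq_mul]
  refine le_trans (ENNReal.toReal_mono (measure_ne_top _ _) (measure_mono_ae ?_)) hunion
  have hξ : ∀ᵐ ω ∂P, ∀ t < T, ‖ξ t ω‖ ≤ Gf := by
    rw [ae_all_iff]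
    intro t
    by_cases ht : t < T
    · filter_upwards [h.subgradients.bounded t ht] with ω h1 _ using h1
    · exact ae_of_all _ fun ω h => absurd h ht
  filter_upwards [hξ] with ω hω hbad
  by_contra hgood
  refine hbad fun j => ?_
  have hg1 : ∑ t ∈ Finset.range T, Y j t ω < 2 * b * Real.sqrt (2 * T * L) :=
    lt_of_not_ge fun hle => hgood (Or.inl (Set.mem_iUnion.2 ⟨j, hle⟩))
  have hg2 : ∀ t < T, ω ∈ ok t := by
    intro t ht l
    refine le_trans (mul_le_mul_of_nonneg_left ?_ (by positivity)) hb
    refine abs_max_zero_sub_lightState_μ_le hd h.init_mem hη.le hω ht.le l ?_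
    by_contra! hc
    -- Only times `t > n` need a refresh, and their windows start at `t - n`; hence the condition `b
    -- + n < T` in the missed event.
    refine hgood (Or.inr ⟨t - n, by omega, l, fun s hs => hc.2 (t - n) (by omega) s hs⟩)
  have hreg := sum_sub_sum_mul_le (T := T) (B := γ * Lg * D + b) hη
    (add_pos_of_nonneg_of_pos (mul_nonneg (mul_nonneg hγ.le Lg.coe_nonneg)
      (by linarith [hd.D_pos])) hb0)
    (p := fun t => (st t ω).p) (x := fun t => gain g γ k (st t ω) (S t ω))
    (fun j => by rw [lightState_zero]) (fun t _ => by rw [lightState_succ])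
    (fun t ht l => abs_gain_le hd hu h.init_mem t ω l (hg2 t ht l) (S t ω)) j
  -- The true regret is the regret on the sampled gains plus the noise `Y`, because `γ φ = gain + γ
  -- e V` with `V = 1 - (m / k) 1_{l ∈ S}` of conditional mean zero.
  have hsum : ∑ t ∈ Finset.range T, γ * (max 0 (g j (st t ω).w) -
        ∑ l, (st t ω).p l * max 0 (g l (st t ω).w)) =
      ∑ t ∈ Finset.range T, (gain g γ k (st t ω) (S t ω) j -
        ∑ l, (st t ω).p l * gain g γ k (st t ω) (S t ω) l) + ∑ t ∈ Finset.range T, Y j t ω := by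
    rw [← Finset.sum_add_distrib]
    refine Finset.sum_congr rfl fun t ht => ?_
    have hφg : ∀ l, γ * φ l t ω = gain g γ k (st t ω) (S t ω) l + γ * e l t ω * V l t ω := by
      intro l
      simp only [gain, he, hV, hφ]
      split_ifs <;> ring
    have hYe : Y j t ω = γ * e j t ω * V j t ω -
        ∑ l, (st t ω).p l * (γ * e l t ω * V l t ω) := by
      rw [hYs]
      have : ∀ l, F j l t ω * V l t ω = (if l = j then γ * e l t ω * V l t ω else 0) -
          (st t ω).p l * (γ * e l t ω * V l t ω) := by
        intro l
        rw [hF1 j l t ω (hg2 t (Finset.mem_range.1 ht))]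
        split_ifs <;> ring
      simp only [this, Finset.sum_sub_distrib, Finset.sum_ite_eq', Finset.mem_univ, if_true]
    have h3 : γ * ∑ l, (st t ω).p l * φ l t ω = ∑ l, (st t ω).p l *
        gain g γ k (st t ω) (S t ω) l + ∑ l, (st t ω).p l * (γ * e l t ω * V l t ω) := by
      rw [← Finset.sum_add_distrib, Finset.mul_sum]
      refine Finset.sum_congr rfl fun l _ => ?_
      rw [← mul_add, ← hφg l]; ring
    have h4 := hφg j
    simp only [hφ] at h3 h4
    rw [mul_sub, h3, h4, hYe]
    ring
  rw [hsum]
  linarith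

end Weights

/-! ### Choice of the parameters -/

section Parameters

/-- The factor 3 serves the split of `δ` among three failure events. Passing to a product lets the
square roots taken later factor. -/
lemma log_three_mul_le {x y z : ℝ} (hx : 1 ≤ x) (hy : 1 ≤ y) (hz : 1 ≤ z) :
    Real.log (3 * (x * y * z)) ≤ 2 * ((1 + Real.log x) * (1 + Real.log y) * (1 + Real.log z)) := by
  have h3 : Real.log 3 ≤ 2 := by
    rw [Real.log_le_iff_le_exp (by norm_num)]
    linarith [Real.add_one_le_exp (2 : ℝ)]
  have hx0 := Real.log_nonneg hx
  have hy0 := Real.log_nonneg hy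
  have hz0 := Real.log_nonneg hz
  rw [Real.log_mul (by norm_num) (by positivity), Real.log_mul (by positivity) (by positivity),
    Real.log_mul (by positivity) (by positivity)]
  have h1 := mul_nonneg hx0 hy0
  have h2 := mul_nonneg hx0 hz0
  have h4 := mul_nonneg hy0 hz0
  have h5 := mul_nonneg h1 hz0
  nlinarith

variable {m T : ℕ} {D A δ ε c : ℝ}

lemma one_le_one_add_log_natCast (n : ℕ) : 1 ≤ 1 + Real.log n := by
  linarith [Real.log_natCast_nonneg n]

lemma one_le_one_add_log_inv (hδ : 0 < δ) (hδ1 : δ < 1) : 1 ≤ 1 + Real.log (1 / δ) := by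
  have : 0 ≤ Real.log (1 / δ) := Real.log_nonneg (by rw [le_div_iff₀ hδ]; linarith)
  linarith

lemma iterations_pos (hc : 0 < c) (hD : 0 < D) (hA : 0 < A) (hε : 0 < ε) (hδ : 0 < δ)
    (hδ1 : δ < 1) : 0 < iterations c m D A δ ε := by
  have h1 := one_le_one_add_log_natCast m
  have h2 := one_le_one_add_log_inv hδ hδ1
  exact Nat.ceil_pos.2 (by positivity)

/-- The choice of `T` read backwards: an error of `a` units `D A √(1 + ln m) √(1 + ln (1/δ)) √T` is
at most `ε T`. -/
lemma le_mul_sqrt_iterations {a : ℝ} (hD : 0 < D) (hA : 0 < A) (hε : 0 < ε)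
    (hδ : 0 < δ) (hδ1 : δ < 1) :
    a * (D * A * Real.sqrt (1 + Real.log m) * Real.sqrt (1 + Real.log (1 / δ))) ≤
      ε * Real.sqrt (iterations (a ^ 2) m D A δ ε) := by
  have h1 := one_le_one_add_log_natCast m
  have h2 := one_le_one_add_log_inv hδ hδ1
  have h := Nat.le_ceil (a ^ 2 * ((1 + Real.log m) * D ^ 2 * A ^ 2 * (1 + Real.log (1 / δ)) / ε ^ 2))
  rw [show ε = Real.sqrt (ε ^ 2) from (Real.sqrt_sq hε.le).symm, ← Real.sqrt_mul (by positivity),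
    Real.sqrt_sq hε.le]
  refine Real.le_sqrt_of_sq_le ?_
  rw [mul_pow, mul_pow, mul_pow, mul_pow, Real.sq_sqrt (by linarith), Real.sq_sqrt (by linarith)]
  unfold iterations
  calc _ = ε ^ 2 * (a ^ 2 * ((1 + Real.log m) * D ^ 2 * A ^ 2 * (1 + Real.log (1 / δ)) / ε ^ 2)) := by
        field_simp
    _ ≤ _ := by gcongr

/-- The total error of a run of LightTouch is at most a multiple of `D A √T`. -/
lemma light_error_le {a e s L₁ L₂ M G β η : ℝ} (ha : 1 ≤ a) (he : 1 ≤ e) (hs : 0 < s)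
    (hD : 1 ≤ D) (hA : 0 < A) (hG : 0 ≤ G) (hGA : G ≤ A) (hβ : 0 ≤ β) (hβA : β ≤ A)
    (hη : η = a * D / (A * s)) (hM : M ≤ a ^ 2) (hL₁ : L₁ ≤ 2 * e ^ 2)
    (hL₂ : L₂ ≤ 2 * (a ^ 2 * e ^ 2)) :
    D ^ 2 / (2 * η) + η * s ^ 2 * G ^ 2 / 2 + 2 * (A * D) * Real.sqrt (2 * s ^ 2 * L₁) +
      (M / η + 2 * η * s ^ 2 * (β + 4 * A) ^ 2 + 2 * (4 * A) * Real.sqrt (2 * s ^ 2 * L₂)) ≤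
      100 * (D * A * a * e) * s := by
  have hD0 : 0 < D := by linarith
  have ha0 : 0 < a := by linarith
  have he0 : 0 < e := by linarith
  -- All terms are measured in this unit, where `s` stands for `√T`, `a` for `√(1 + ln m)` and `e`
  -- for `√(1 + ln (1/δ))`. They add up to `73 U`, rounded up to 100.
  set U := D * A * a * e * s with hU
  have hDAs : 0 < D * A * s := by positivity
  have haU : D * A * s * a ≤ U := by
    rw [hU]; nlinarith [mul_pos hDAs ha0]
  have h1U : D * A * s ≤ U := by nlinarith
  have hηs : η * s ^ 2 = D * a * s / A := by rw [hη]; field_simp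
  have hη0 : 0 < η := by rw [hη]; positivity
  have t1 : D ^ 2 / (2 * η) ≤ U := by
    have : D ^ 2 / (2 * η) = D * A * s / (2 * a) := by rw [hη]; field_simp
    rw [this, div_le_iff₀ (by positivity)]
    nlinarith
  have t2 : η * s ^ 2 * G ^ 2 / 2 ≤ U := by
    have hG2 : G ^ 2 ≤ A ^ 2 := by gcongr
    calc η * s ^ 2 * G ^ 2 / 2 ≤ η * s ^ 2 * A ^ 2 := by
          have : 0 ≤ η * s ^ 2 := by positivity
          nlinarith [sq_nonneg G]
      _ = D * A * s * a := by rw [hηs]; field_simp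
      _ ≤ U := haU
  have t3 : Real.sqrt (2 * s ^ 2 * L₁) ≤ 2 * (e * s) := by
    refine Real.sqrt_le_iff.2 ⟨by positivity, ?_⟩
    nlinarith [mul_le_mul_of_nonneg_left hL₁ (by positivity : 0 ≤ 2 * s ^ 2)]
  have t4 : Real.sqrt (2 * s ^ 2 * L₂) ≤ 2 * (a * e * s) := by
    refine Real.sqrt_le_iff.2 ⟨by positivity, ?_⟩
    nlinarith [mul_le_mul_of_nonneg_left hL₂ (by positivity : 0 ≤ 2 * s ^ 2)]
  have t3' : 2 * (A * D) * Real.sqrt (2 * s ^ 2 * L₁) ≤ 4 * U := by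
    calc _ ≤ 2 * (A * D) * (2 * (e * s)) := by gcongr
      _ = 4 * (D * A * s * e) := by ring
      _ ≤ 4 * U := by
        have : D * A * s * e ≤ D * A * s * e * a := le_mul_of_one_le_right (by positivity) ha
        rw [hU]; nlinarith
  have t4' : 2 * (4 * A) * Real.sqrt (2 * s ^ 2 * L₂) ≤ 16 * U := by
    calc _ ≤ 2 * (4 * A) * (2 * (a * e * s)) := by gcongr
      _ = 16 * (A * a * e * s) := by ring
      _ ≤ 16 * U := by
        have : A * a * e * s ≤ A * a * e * s * D := le_mul_of_one_le_right (by positivity) hD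
        rw [hU]; nlinarith
  have t5 : M / η ≤ U := by
    rw [div_le_iff₀ hη0]
    refine hM.trans ?_
    have : U * η = a ^ 2 * (e * D ^ 2) := by rw [hU, hη]; field_simp
    rw [this]
    refine le_mul_of_one_le_right (by positivity) ?_
    nlinarith
  have t6 : 2 * η * s ^ 2 * (β + 4 * A) ^ 2 ≤ 50 * U := by
    have hb : (β + 4 * A) ^ 2 ≤ (5 * A) ^ 2 := by gcongr; linarith
    calc 2 * η * s ^ 2 * (β + 4 * A) ^ 2 ≤ 2 * η * s ^ 2 * (5 * A) ^ 2 := by gcongr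
      _ = 50 * (η * s ^ 2 * A ^ 2) := by ring
      _ = 50 * (D * A * s * a) := by rw [hηs]; field_simp
      _ ≤ 50 * U := by linarith
  have hU0 : 0 < U := by positivity
  calc _ ≤ U + U + 4 * U + (U + 50 * U + 16 * U) := by linarith
    _ ≤ 100 * U := by linarith
    _ = _ := by rw [hU]; ring

/-- The total error of a run of FullTouch is at most a multiple of `D A √T`. -/
lemma full_error_le {a e s L G η : ℝ} (ha : 1 ≤ a) (he : 1 ≤ e) (hs : 0 < s)
    (hD : 1 ≤ D) (hA : 0 < A) (hG : 0 < G) (hGA : G ≤ A) (hη : η = D / (G * s))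
    (hL : L ≤ 2 * e ^ 2) :
    D ^ 2 / (2 * η) + η * s ^ 2 * G ^ 2 / 2 + 2 * (A * D) * Real.sqrt (2 * s ^ 2 * L) ≤
      100 * (D * A * a * e) * s := by
  have hD0 : 0 < D := by linarith
  have h1 : D ^ 2 / (2 * η) + η * s ^ 2 * G ^ 2 / 2 = D * G * s := by
    rw [hη]; field_simp; ring
  have t3 : Real.sqrt (2 * s ^ 2 * L) ≤ 2 * (e * s) := by
    refine Real.sqrt_le_iff.2 ⟨by positivity, ?_⟩
    nlinarith [mul_le_mul_of_nonneg_left hL (by positivity : 0 ≤ 2 * s ^ 2)]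
  rw [h1]
  calc D * G * s + 2 * (A * D) * Real.sqrt (2 * s ^ 2 * L)
      ≤ D * A * s + 2 * (A * D) * (2 * (e * s)) := by gcongr
    _ = D * A * s * (1 + 4 * e) := by ring
    _ ≤ D * A * s * (100 * (a * e)) := by
        gcongr
        nlinarith
    _ = _ := by ring

lemma sq_rpow_quarter {x : ℝ} (hx : 0 ≤ x) : (x ^ (1 / 4 : ℝ)) ^ 2 = Real.sqrt x := by
  rw [← Real.rpow_natCast, ← Real.rpow_mul hx, Real.sqrt_eq_rpow]; norm_num

lemma sq_rpow_three_quarters {x : ℝ} (hx : 0 ≤ x) :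
    (x ^ (3 / 4 : ℝ)) ^ 2 = Real.sqrt x ^ 3 := by
  rw [← Real.rpow_natCast, ← Real.rpow_mul hx, Real.sqrt_eq_rpow, ← Real.rpow_natCast,
    ← Real.rpow_mul hx]
  norm_num

/-- The minibatches are large enough for the staleness to be controlled. -/
lemma sq_div_minibatchSize_mul_le {k : ℕ} (hT : 0 < T) (hk0 : 0 < k) (hk : k = minibatchSize m δ T)
    (hδ : 0 < δ) (hδ1 : δ < 1) :
    ((m : ℝ) / k) ^ 2 * (Real.sqrt (1 + Real.log m) ^ 3 * (1 + Real.log (1 / δ)) *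
      (1 + Real.log T)) ≤ Real.sqrt T := by
  have h1 := one_le_one_add_log_natCast m
  have h2 := one_le_one_add_log_inv hδ hδ1
  have h3 := one_le_one_add_log_natCast T
  have hT' : (0 : ℝ) < T := Nat.cast_pos.2 hT
  have hk' : (0 : ℝ) < k := Nat.cast_pos.2 hk0
  have hle := Nat.le_ceil ((m : ℝ) * (1 + Real.log m) ^ (3 / 4 : ℝ) *
    Real.sqrt (1 + Real.log (1 / δ)) * Real.sqrt (1 + Real.log T) / (T : ℝ) ^ (1 / 4 : ℝ))
  rw [show ⌈_⌉₊ = k from hk.symm, div_le_iff₀ (by positivity)] at hle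
  have hsq := pow_le_pow_left₀ (by positivity) hle 2
  rw [mul_pow, mul_pow, mul_pow, mul_pow, sq_rpow_quarter hT'.le,
    sq_rpow_three_quarters (by linarith), Real.sq_sqrt (by linarith),
    Real.sq_sqrt (by linarith)] at hsq
  rw [div_pow, div_mul_eq_mul_div, div_le_iff₀ (by positivity)]
  linarith

/-- `ε ≤ D A` makes the quantity under the ceiling, without `c`, at least 1, so rounding costs at
most one further multiple. -/
lemma iterations_le (hc : 0 < c) (hD : 0 < D) (hA : 0 < A) (hε : 0 < ε) (hδ : 0 < δ)
    (hδ1 : δ < 1) (hεDA : ε ≤ D * A) :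
    (iterations c m D A δ ε : ℝ) ≤
      (c + 1) * ((1 + Real.log m) * D ^ 2 * A ^ 2 * (1 + Real.log (1 / δ)) / ε ^ 2) := by
  have h1 := one_le_one_add_log_natCast m
  have h2 := one_le_one_add_log_inv hδ hδ1
  set M := (1 + Real.log m) * D ^ 2 * A ^ 2 * (1 + Real.log (1 / δ)) / ε ^ 2 with hM
  have hM1 : 1 ≤ M := by
    rw [hM, one_le_div (by positivity)]
    calc ε ^ 2 ≤ (D * A) ^ 2 := by gcongr
      _ = 1 * D ^ 2 * A ^ 2 * 1 := by ring
      _ ≤ _ := by gcongr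
  have := (Nat.ceil_lt_add_one (by positivity : 0 ≤ c * M)).le
  unfold iterations
  linarith

/-- The product of `T^{3/4}` with the factors of `T^{1/4} k`: the exponents are `3/4 + 3/4 = 3/2`
for `1 + ln m` and `3/4 + 1/2 = 5/4` for `1 + ln (1/δ)`. -/
lemma rpow_combine {x y u v z : ℝ} (hx : 0 < x) (hy : 0 < y) (hu : 0 < u) (hv : 0 < v)
    (hz : 0 < z) :
    (x * u ^ 2 * v ^ 2 * y / z ^ 2) ^ (3 / 4 : ℝ) * (x ^ (3 / 4 : ℝ) * Real.sqrt y) =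
      x ^ (3 / 2 : ℝ) * u ^ (3 / 2 : ℝ) * v ^ (3 / 2 : ℝ) * y ^ (5 / 4 : ℝ) / z ^ (3 / 2 : ℝ) := by
  have h : ∀ t : ℝ, 0 < t → (t ^ 2) ^ (3 / 4 : ℝ) = t ^ (3 / 2 : ℝ) := fun t ht => by
    rw [← Real.rpow_natCast, ← Real.rpow_mul ht.le]; norm_num
  have hx2 : x ^ (3 / 2 : ℝ) = x ^ (3 / 4 : ℝ) * x ^ (3 / 4 : ℝ) := by
    rw [← Real.rpow_add hx]; norm_num
  have hy2 : y ^ (5 / 4 : ℝ) = y ^ (3 / 4 : ℝ) * Real.sqrt y := by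
    rw [Real.sqrt_eq_rpow, ← Real.rpow_add hy]; norm_num
  rw [Real.div_rpow (by positivity) (by positivity), Real.mul_rpow (by positivity) hy.le,
    Real.mul_rpow (by positivity) (by positivity), Real.mul_rpow hx.le (by positivity),
    h u hu, h v hv, h z hz, hx2, hy2]
  ring

/-- The two quantities that make up the number of constraint checks, compared with the two terms
of the bound. -/
lemma checks_estimates (hm : 0 < m) (hc : 0 < c) (hD : 1 ≤ D) (hA : 0 < A) (hε : 0 < ε)
    (hδ : 0 < δ) (hδ1 : δ < 1) (hεDA : ε ≤ D * A) (hT : T = iterations c m D A δ ε) :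
    ∃ M N : ℝ, M + N = checksBound m D A δ ε T ∧ 0 ≤ M ∧ (T : ℝ) ≤ (c + 1) * M ∧ (m : ℝ) ≤ N ∧
      (T : ℝ) * ((m : ℝ) * (1 + Real.log m) ^ (3 / 4 : ℝ) * Real.sqrt (1 + Real.log (1 / δ)) *
        Real.sqrt (1 + Real.log T) / (T : ℝ) ^ (1 / 4 : ℝ)) ≤ (c + 1) * N := by
  have h1 := one_le_one_add_log_natCast m
  have h2 := one_le_one_add_log_inv hδ hδ1
  have h3 := one_le_one_add_log_natCast T
  have hD0 : 0 < D := by linarith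
  have hm' : (0 : ℝ) < m := Nat.cast_pos.2 hm
  have hT0 : (0 : ℝ) < T := Nat.cast_pos.2 (hT ▸ iterations_pos hc hD0 hA hε hδ hδ1)
  have hTM := iterations_le (m := m) hc hD0 hA hε hδ hδ1 hεDA
  rw [← hT] at hTM
  have hcomb := rpow_combine (x := 1 + Real.log m) (y := 1 + Real.log (1 / δ)) (u := D) (v := A)
    (z := ε) (by linarith) (by linarith) hD0 hA hε
  have hl : Real.sqrt (1 + Real.log T) ≥ 1 := Real.one_le_sqrt.2 h3
  set x := 1 + Real.log m
  set y := 1 + Real.log (1 / δ)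
  set l := Real.sqrt (1 + Real.log T)
  have hcore : x ^ (3 / 2 : ℝ) * D ^ (3 / 2 : ℝ) * A ^ (3 / 2 : ℝ) * y ^ (5 / 4 : ℝ) /
      ε ^ (3 / 2 : ℝ) ≥ 1 := by
    rw [ge_iff_le, one_le_div (by positivity)]
    calc ε ^ (3 / 2 : ℝ) ≤ (D * A) ^ (3 / 2 : ℝ) := by gcongr
      _ = 1 * D ^ (3 / 2 : ℝ) * A ^ (3 / 2 : ℝ) * 1 := by
        rw [Real.mul_rpow hD0.le hA.le]; ring
      _ ≤ _ := by
        gcongr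
        · exact Real.one_le_rpow h1 (by norm_num)
        · exact Real.one_le_rpow h2 (by norm_num)
  refine ⟨x * D ^ 2 * A ^ 2 * y / ε ^ 2, m * x ^ (3 / 2 : ℝ) * D ^ (3 / 2 : ℝ) *
    A ^ (3 / 2 : ℝ) * y ^ (5 / 4 : ℝ) / ε ^ (3 / 2 : ℝ) * l, rfl, by positivity, hTM, ?_, ?_⟩
  · calc (m : ℝ) = m * 1 * 1 := by ring
      _ ≤ m * (x ^ (3 / 2 : ℝ) * D ^ (3 / 2 : ℝ) * A ^ (3 / 2 : ℝ) * y ^ (5 / 4 : ℝ) /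
          ε ^ (3 / 2 : ℝ)) * l := by gcongr
      _ = _ := by ring
  · set M := x * D ^ 2 * A ^ 2 * y / ε ^ 2
    have hT34 : (T : ℝ) / (T : ℝ) ^ (1 / 4 : ℝ) = (T : ℝ) ^ (3 / 4 : ℝ) := by
      rw [div_eq_iff (by positivity), ← Real.rpow_add hT0]; norm_num
    have hTle : (T : ℝ) ^ (3 / 4 : ℝ) ≤ (c + 1) * M ^ (3 / 4 : ℝ) := by
      calc (T : ℝ) ^ (3 / 4 : ℝ) ≤ ((c + 1) * M) ^ (3 / 4 : ℝ) := by gcongr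
        _ = (c + 1) ^ (3 / 4 : ℝ) * M ^ (3 / 4 : ℝ) :=
          Real.mul_rpow (by positivity) (by positivity)
        _ ≤ _ := by
          gcongr
          calc (c + 1) ^ (3 / 4 : ℝ) ≤ (c + 1) ^ (1 : ℝ) :=
                Real.rpow_le_rpow_of_exponent_le (by linarith) (by norm_num)
            _ = c + 1 := Real.rpow_one _
    calc (T : ℝ) * (m * x ^ (3 / 4 : ℝ) * Real.sqrt y * l / (T : ℝ) ^ (1 / 4 : ℝ))
        = (T : ℝ) / (T : ℝ) ^ (1 / 4 : ℝ) * (m * x ^ (3 / 4 : ℝ) * Real.sqrt y * l) := by ring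
      _ ≤ (c + 1) * M ^ (3 / 4 : ℝ) * (m * x ^ (3 / 4 : ℝ) * Real.sqrt y * l) := by
          rw [hT34]; gcongr
      _ = (c + 1) * (m * (M ^ (3 / 4 : ℝ) * (x ^ (3 / 4 : ℝ) * Real.sqrt y)) * l) := by ring
      _ = _ := by rw [hcomb]; ring

end Parameters

/-! ### From regret to the guarantee -/

section Conclusion

variable {Ω : Type*} {mΩ : MeasurableSpace Ω} {P : Measure Ω} [IsProbabilityMeasure P]
  {ℱ : Filtration ℕ mΩ} {d m : ℕ} [NeZero m] {W : Set (E d)} {f : E d → ℝ}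
  {g : Fin m → E d → ℝ} {dg : Fin m → E d → E d} {Lg : ℝ≥0} {D Gf Gg γ η : ℝ} {k T : ℕ}
  {w₁ : Ω → E d} {ξ : ℕ → Ω → E d} {i : ℕ → Ω → Fin m} {S : ℕ → Ω → Finset (Fin m)}

/-- Only subadditivity is used, so neither event has to be measurable. -/
lemma one_sub_le_measureReal {s bad : Set Ω} {δ : ℝ} (h : ∀ ω ∉ bad, ω ∈ s)
    (hbad : P.real bad ≤ δ) : 1 - δ ≤ P.real s := by
  have h1 : P.real (s ∪ bad) = 1 := by
    have : s ∪ bad = Set.univ := Set.eq_univ_of_forall fun ω => by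
      by_cases hω : ω ∈ bad
      · exact Or.inr hω
      · exact Or.inl (h ω hω)
    rw [this, probReal_univ]
  linarith [measureReal_union_le (μ := P) s bad]

lemma average_mem (hW : Convex ℝ W) (hT : 0 < T) {w : ℕ → E d} (hw : ∀ t, w t ∈ W) :
    (T : ℝ)⁻¹ • ∑ t ∈ Finset.range T, w t ∈ W := by
  have hT' : (T : ℝ) ≠ 0 := (Nat.cast_pos.2 hT).ne'
  rw [Finset.smul_sum]
  exact hW.sum_mem (fun _ _ => by positivity) (by simp [hT']) fun t _ => hw t

/-- At the average the maximum is attained by a single index `j`, so Jensen is applied to `f + γ max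
0 g_j` alone; a regret bound for each fixed `j` suffices. -/
lemma penalized_average_sub_le (hγ : 0 ≤ γ) (hf : ConvexOn ℝ W f) (hg : ∀ i, ConvexOn ℝ W (g i))
    (hT : 0 < T) {w : ℕ → E d} (hw : ∀ t, w t ∈ W) {a ε : ℝ}
    (h : ∀ j, ∑ t ∈ Finset.range T, (f (w t) + γ * max 0 (g j (w t)) - a) ≤ ε * T) :
    penalized f g γ ((T : ℝ)⁻¹ • ∑ t ∈ Finset.range T, w t) - a ≤ ε := by
  have hT' : (0 : ℝ) < T := Nat.cast_pos.2 hT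
  obtain ⟨j, hj⟩ := exists_eq_maxConstraint (g := g) ((T : ℝ)⁻¹ • ∑ t ∈ Finset.range T, w t)
  rw [penalized, hj]
  have hcv : ConvexOn ℝ W fun x => f x + γ * max 0 (g j x) :=
    hf.add ((convexOn_pos_part (hg j)).smul hγ)
  have h1 := hcv.map_sum_le (t := Finset.range T) (w := fun _ => (T : ℝ)⁻¹) (p := w)
    (fun _ _ => by positivity) (by simp [hT'.ne']) fun t _ => hw t
  rw [← Finset.smul_sum, ← Finset.smul_sum, smul_eq_mul] at h1
  have h2 := h j
  rw [Finset.sum_sub_distrib, Finset.sum_const, Finset.card_range, nsmul_eq_mul] at h2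
  have h3 : (T : ℝ)⁻¹ * ∑ t ∈ Finset.range T, (f (w t) + γ * max 0 (g j (w t))) ≤ ε + a := by
    rw [inv_mul_le_iff₀ hT']; linarith
  linarith

lemma natCast_mul_one_sub_pow_le {n : ℕ} {Λ : ℝ} (hk0 : 0 < k) (hk : k ≤ m)
    (hn : (m : ℝ) / k * Λ ≤ n) : (1 - (k : ℝ) / m) ^ n ≤ Real.exp (-Λ) := by
  have hm : (0 : ℝ) < m := Nat.cast_pos.2 (NeZero.pos m)
  have hk' : (0 : ℝ) < k := Nat.cast_pos.2 hk0
  have hr : 0 ≤ 1 - (k : ℝ) / m := by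
    rw [sub_nonneg, div_le_one hm]; exact_mod_cast hk
  refine (pow_le_pow_left₀ hr (Real.one_sub_le_exp_neg _) n).trans ?_
  rw [← Real.exp_nat_mul]
  refine Real.exp_le_exp.2 ?_
  have h1 : Λ ≤ n * ((k : ℝ) / m) := by
    calc Λ = (m : ℝ) / k * Λ * ((k : ℝ) / m) := by field_simp
      _ ≤ _ := by gcongr
  linarith

/-- LightTouch is close to optimal with high probability. -/
lemma measureReal_light_le (hd : ConvexData W g dg Lg D Gf Gg γ) {A ε δ : ℝ}
    (hA : A = Gf + γ * Gg + γ * Lg * D) (hG : 0 < Gf + γ * Gg) (hε : 0 < ε) (hδ : 0 < δ)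
    (hδ1 : δ < 1) (hT : T = iterations (100 ^ 2) m D A δ ε) (hkT : k = minibatchSize m δ T)
    (hk : k ≤ m) (hη : η = Real.sqrt (1 + Real.log m) * D / (A * Real.sqrt T))
    (h : LightExecution P ℱ W f g dg Gf γ η k T w₁ ξ i S) {u : E d} (hu : u ∈ feasible W g) :
    P.real {ω | ¬ ∀ j, ∑ t ∈ Finset.range T, (f (lightState W g dg γ η k w₁ ξ i S t ω).w +
      γ * max 0 (g j (lightState W g dg γ η k w₁ ξ i S t ω).w) - f u) ≤ ε * T} ≤ δ := by
  have hγ := hd.γ_pos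
  have hD := hd.D_pos
  have hD0 : 0 < D := by linarith
  have hβ : 0 ≤ γ * Lg * D := by positivity
  have hA0 : 0 < A := by linarith
  have hT0 : 0 < T := hT ▸ iterations_pos (by norm_num) hD0 hA0 hε hδ hδ1
  have hT' : (0 : ℝ) < T := Nat.cast_pos.2 hT0
  have hm : (0 : ℝ) < m := Nat.cast_pos.2 (NeZero.pos m)
  have hm1 : (1 : ℝ) ≤ m := by exact_mod_cast NeZero.pos m
  have hT1 : (1 : ℝ) ≤ T := by exact_mod_cast hT0
  have hδ' : 1 ≤ 1 / δ := by rw [le_div_iff₀ hδ]; linarith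
  have l1 := one_le_one_add_log_natCast m
  have l2 := one_le_one_add_log_inv hδ hδ1
  have l3 := one_le_one_add_log_natCast T
  have hk0 : 0 < k := hkT ▸ Nat.ceil_pos.2 (by positivity)
  have hk' : (0 : ℝ) < k := Nat.cast_pos.2 hk0
  have hbatch := sq_div_minibatchSize_mul_le hT0 hk0 hkT hδ hδ1
  have herr := le_mul_sqrt_iterations (m := m) (a := 100) hD0 hA0 hε hδ hδ1
  rw [← hT] at herr
  have L1le := log_three_mul_le (x := 1) (y := 1) le_rfl le_rfl hδ'
  have L2le := log_three_mul_le (y := 1) hm1 le_rfl hδ'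
  have Λle := log_three_mul_le hm1 hT1 hδ'
  simp only [Real.log_one, add_zero, mul_one, one_mul] at L1le L2le
  set a := Real.sqrt (1 + Real.log m) with ha
  set e := Real.sqrt (1 + Real.log (1 / δ)) with he
  set s := Real.sqrt T with hs
  have ha1 : 1 ≤ a := Real.one_le_sqrt.2 l1
  have he1 : 1 ≤ e := Real.one_le_sqrt.2 l2
  have hs0 : 0 < s := Real.sqrt_pos.2 hT'
  have ha2 : a ^ 2 = 1 + Real.log m := Real.sq_sqrt (by linarith)
  have he2 : e ^ 2 = 1 + Real.log (1 / δ) := Real.sq_sqrt (by linarith)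
  have hs2 : s ^ 2 = T := Real.sq_sqrt hT'.le
  have ha0 : 0 < a := by linarith
  have hη0 : 0 < η := by rw [hη]; positivity
  -- With `n ≥ (m / k) Λ`, the union bound over `T m` pairs gives a missed-index probability of at
  -- most `T m exp (-Λ) = δ / 3`.
  set Λ := Real.log (3 * (m * T * (1 / δ))) with hΛ
  have hΛ1 : 1 ≤ Λ := by
    rw [hΛ, Real.le_log_iff_exp_le (by positivity)]
    have : 1 ≤ (m : ℝ) * T * (1 / δ) := one_le_mul_of_one_le_of_one_le
      (one_le_mul_of_one_le_of_one_le hm1 hT1) hδ'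
    linarith [Real.exp_one_lt_d9]
  set r := (m : ℝ) / k with hr
  have hr1 : 1 ≤ r := by rw [hr, one_le_div hk']; exact_mod_cast hk
  set n := ⌈r * Λ⌉₊ with hn
  have hnle : r * Λ ≤ n := Nat.le_ceil _
  have hnge : (n : ℝ) ≤ 2 * (r * Λ) := by
    have h1 := (Nat.ceil_lt_add_one (by positivity : 0 ≤ r * Λ)).le
    have h2 : 1 ≤ r * Λ := one_le_mul_of_one_le_of_one_le hr1 hΛ1
    linarith
  -- The minibatch size enters here. One factor `m / k` comes from the magnification and one from
  -- the waiting time `n`; `a³` is `a²` from `Λ` times `a` from `η`. The constant 4 is 2 from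
  -- rounding `n` times 2 from `log_three_mul_le`.
  have hstale : γ * m / k * (n * (Lg * (η * (Gf + γ * Gg)))) ≤ 4 * A := by
    have hGA : η * (Gf + γ * Gg) ≤ η * A := by
      refine mul_le_mul_of_nonneg_left ?_ hη0.le
      linarith
    have hηA : η * A = a * D / s := by rw [hη]; field_simp
    have hΛ' : Λ ≤ 2 * (a ^ 2 * (1 + Real.log T) * (1 + Real.log (1 / δ))) := by rwa [ha2]
    calc γ * m / k * (n * (Lg * (η * (Gf + γ * Gg))))
        ≤ γ * m / k * (2 * (r * (2 * (a ^ 2 * (1 + Real.log T) * (1 + Real.log (1 / δ))))) *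
          (Lg * (a * D / s))) := by
          rw [← hηA]
          gcongr
          refine hnge.trans ?_
          gcongr
      _ = 4 * (γ * Lg * D / s) * (r ^ 2 * (a ^ 3 * (1 + Real.log (1 / δ)) *
          (1 + Real.log T))) := by rw [hr]; ring
      _ ≤ 4 * (γ * Lg * D / s) * s := by gcongr
      _ = 4 * (γ * Lg * D) := by field_simp
      _ ≤ 4 * A := by linarith
  have hL1 : 0 ≤ Real.log (3 * (1 / δ)) := Real.log_nonneg (by linarith)
  have hL2 : 0 ≤ Real.log (3 * (m * (1 / δ))) := Real.log_nonneg (by nlinarith)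
  have hWm := lightState_w_mem (g := g) (dg := dg) (γ := γ) (η := η) (k := k) (ξ := ξ) (i := i)
    (S := S) hd.isClosed h.init_mem
  have hdesc := measureReal_descent_le hd hT0 (b := 2 * (A * D)) (L := Real.log (3 * (1 / δ))) hη0
    hL1 (by positivity) (by
      have : (Gf + γ * Gg) * D ≤ A * D := by
        refine mul_le_mul_of_nonneg_right ?_ hD0.le
        linarith
      linarith)
    (fun t ht => (measurable_lightState hd h ht.le).1) hWm h.subgradients h.index_adapted
    h.index_law (fun t ω j => lightState_p_nonneg t ω j)
    (fun t ω => by rw [lightState_succ]) hu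
  have hweights := measureReal_weights_le hd hη0 h hT0 hk0 hk hu (n := n) (b := 4 * A)
    (L := Real.log (3 * (m * (1 / δ)))) (by positivity) hstale hL2
  -- Descent noise, weight noise (a union over `m` indices) and missed refreshes each receive `δ /
  -- 3`.
  have hprob : Real.exp (-Real.log (3 * (1 / δ))) + (m * Real.exp (-Real.log (3 * (m * (1 / δ)))) +
      T * m * (1 - (k : ℝ) / m) ^ n) ≤ δ := by
    have h1 := mul_le_mul_of_nonneg_left (natCast_mul_one_sub_pow_le hk0 hk hnle)
      (by positivity : (0 : ℝ) ≤ T * m)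
    rw [hΛ, Real.exp_neg, Real.exp_log (by positivity)] at h1
    rw [Real.exp_neg, Real.exp_neg, Real.exp_log (by positivity), Real.exp_log (by positivity)]
    have e1 : (3 * (1 / δ))⁻¹ = δ / 3 := by field_simp
    have e2 : (m : ℝ) * (3 * (m * (1 / δ)))⁻¹ = δ / 3 := by field_simp
    have e3 : (T : ℝ) * m * (3 * (m * T * (1 / δ)))⁻¹ = δ / 3 := by field_simp
    rw [e1, e2]
    rw [e3] at h1
    linarith
  refine le_trans ?_ ((add_le_add hdesc hweights).trans hprob)
  refine le_trans (measureReal_mono ?_ (measure_ne_top _ _)) (measureReal_union_le _ _)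
  intro ω hω
  by_contra hgood
  rw [Set.mem_union, not_or, Set.mem_ofPred_eq, Set.mem_ofPred_eq, not_not, not_not] at hgood
  refine hω fun j => ?_
  have hfin := light_error_le (M := Real.log m) (L₁ := Real.log (3 * (1 / δ)))
    (L₂ := Real.log (3 * (m * (1 / δ)))) ha1 he1 hs0 hD hA0 hG.le (by linarith) hβ
    (by linarith : γ * Lg * D ≤ A) hη (by rw [ha2]; linarith) (by rwa [he2]) (by rwa [ha2, he2])
  rw [hs2] at hfin
  -- The `p`-average of the constraints is added and subtracted, separating the regrets of the two
  -- players.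
  have hsplit : ∑ t ∈ Finset.range T, (f (lightState W g dg γ η k w₁ ξ i S t ω).w +
      γ * max 0 (g j (lightState W g dg γ η k w₁ ξ i S t ω).w) - f u) =
      ∑ t ∈ Finset.range T, (f (lightState W g dg γ η k w₁ ξ i S t ω).w +
        γ * ∑ l, (lightState W g dg γ η k w₁ ξ i S t ω).p l *
          max 0 (g l (lightState W g dg γ η k w₁ ξ i S t ω).w) - f u) +
      ∑ t ∈ Finset.range T, γ * (max 0 (g j (lightState W g dg γ η k w₁ ξ i S t ω).w) -
        ∑ l, (lightState W g dg γ η k w₁ ξ i S t ω).p l *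
          max 0 (g l (lightState W g dg γ η k w₁ ξ i S t ω).w)) := by
    rw [← Finset.sum_add_distrib]
    exact Finset.sum_congr rfl fun t _ => by ring
  rw [hsplit]
  refine (add_le_add hgood.1 (hgood.2 j)).trans (hfin.trans ?_)
  calc 100 * (D * A * a * e) * s ≤ ε * s * s := by gcongr
    _ = ε * T := by rw [mul_assoc, ← sq, hs2]

/-! ### The run of FullTouch -/

omit [NeZero m] in
lemma fullIter_succ_val (sel : (Fin m → ℝ) → Fin m) (w : E d) (x : ℕ → E d) (t : ℕ) :
    (fullIter W g dg sel γ η w x (t + 1)).val =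
      proj W ((fullIter W g dg sel γ η w x t).val - η • (x t + γ •
        dg (sel fun j => g j (fullIter W g dg sel γ η w x t).val)
          (fullIter W g dg sel γ η w x t).val)) := by
  have : (fullIter W g dg sel γ η w x (t + 1)).val =
      proj W ((fullIter W g dg sel γ η w x t).val - η • (x t + γ •
        dg (sel fun j => if j ∈ Finset.univ then g j (fullIter W g dg sel γ η w x t).val else 0)
          (fullIter W g dg sel γ η w x t).val)) := rfl
  simpa only [Finset.mem_univ, if_true] using this

omit [NeZero m] in
lemma fullIter_checks (sel : (Fin m → ℝ) → Fin m) (w : E d) (x : ℕ → E d) (t : ℕ) :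
    (fullIter W g dg sel γ η w x t).checks = t * (m + 1) := by
  induction t with
  | zero => simp [fullIter, pure]
  | succ t ih =>
    have : (fullIter W g dg sel γ η w x (t + 1)).checks =
      (fullIter W g dg sel γ η w x t).checks + ((∑ _j : Fin m, 1) + (1 + 0)) := rfl
    rw [this, ih]
    simp only [Finset.sum_const, Finset.card_univ, Fintype.card_fin, smul_eq_mul]
    ring

omit [NeZero m] in
lemma fullIter_mem (hW : IsClosed W) (sel : (Fin m → ℝ) → Fin m) {w : E d} (hw : w ∈ W)
    (x : ℕ → E d) (t : ℕ) : (fullIter W g dg sel γ η w x t).val ∈ W := by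
  cases t with
  | zero => exact hw
  | succ t => rw [fullIter_succ_val]; exact proj_mem hW ⟨_, hw⟩ _

omit [NeZero m] in
lemma measurableSet_sel_eq (hd : ConvexData W g dg Lg D Gf Gg γ) {𝒢 : MeasurableSpace Ω}
    {sel : (Fin m → ℝ) → Fin m} (hsel : Measurable sel) {w : Ω → E d} (hw : Measurable[𝒢] w)
    (hW : ∀ ω, w ω ∈ W) (j : Fin m) : MeasurableSet[𝒢] {ω | sel (fun l => g l (w ω)) = j} :=
  (hsel.comp (measurable_pi_lambda _ fun l => hd.measurable_comp hw hW l))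
    (measurableSet_singleton j)

omit [NeZero m] in
lemma measurable_fullIter (hd : ConvexData W g dg Lg D Gf Gg γ) {sel : (Fin m → ℝ) → Fin m}
    (hsel : Measurable sel) (h : FullExecution P ℱ W f g dg sel Gf γ η T w₁ ξ) {t : ℕ}
    (ht : t ≤ T) :
    Measurable[ℱ t] fun ω => (fullIter W g dg sel γ η (w₁ ω) (fun s => ξ s ω) t).val := by
  obtain ⟨ω₀⟩ : Nonempty Ω := P.nonempty_of_neZero
  induction t with
  | zero => exact h.init_measurable.measurable
  | succ t ih =>
    have hw := (ih (by omega)).mono (ℱ.mono (Nat.le_succ t)) le_rfl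
    simp only [fullIter_succ_val]
    exact measurable_proj_step hd η ⟨_, h.init_mem ω₀⟩ hw
      (h.subgradients.adapted t ht).measurable
      (measurableSet_sel_eq hd hsel hw fun ω => fullIter_mem hd.isClosed sel (h.init_mem ω) _ t)

omit [NeZero m] in
/-- FullTouch is close to optimal with high probability. -/
lemma measureReal_full_le (hd : ConvexData W g dg Lg D Gf Gg γ) {A ε δ : ℝ}
    (hA : A = Gf + γ * Gg + γ * Lg * D) (hG : 0 < Gf + γ * Gg) (hε : 0 < ε) (hδ : 0 < δ)
    (hδ1 : δ < 1) (hT : T = iterations (100 ^ 2) m D A δ ε)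
    (hη : η = D / ((Gf + γ * Gg) * Real.sqrt T)) {sel : (Fin m → ℝ) → Fin m}
    (hsel : Measurable sel) (hmax : ∀ (v : Fin m → ℝ) (j : Fin m), v j ≤ v (sel v))
    (h : FullExecution P ℱ W f g dg sel Gf γ η T w₁ ξ) {u : E d} (hu : u ∈ feasible W g) :
    P.real {ω | ¬ ∀ j, ∑ t ∈ Finset.range T,
      (f (fullIter W g dg sel γ η (w₁ ω) (fun s => ξ s ω) t).val +
      γ * max 0 (g j (fullIter W g dg sel γ η (w₁ ω) (fun s => ξ s ω) t).val) - f u) ≤ ε * T} ≤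
      δ := by
  have hγ := hd.γ_pos
  have hD := hd.D_pos
  have hD0 : 0 < D := by linarith
  have hβ : 0 ≤ γ * Lg * D := by positivity
  have hA0 : 0 < A := by linarith
  have hT0 : 0 < T := hT ▸ iterations_pos (by norm_num) hD0 hA0 hε hδ hδ1
  have hT' : (0 : ℝ) < T := Nat.cast_pos.2 hT0
  have l1 := one_le_one_add_log_natCast m
  have l2 := one_le_one_add_log_inv hδ hδ1
  have herr := le_mul_sqrt_iterations (m := m) (a := 100) hD0 hA0 hε hδ hδ1
  rw [← hT] at herr
  have hs0 : 0 < Real.sqrt T := Real.sqrt_pos.2 hT'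
  have hs2 : Real.sqrt T ^ 2 = T := Real.sq_sqrt hT'.le
  have hη0 : 0 < η := by rw [hη]; positivity
  set w : ℕ → Ω → E d := fun t ω => (fullIter W g dg sel γ η (w₁ ω) (fun s => ξ s ω) t).val with hw
  have hwW : ∀ t ω, w t ω ∈ W := fun t ω => fullIter_mem hd.isClosed sel (h.init_mem ω) _ t
  have hwm : ∀ t ≤ T, Measurable[ℱ t] (w t) := fun t ht => measurable_fullIter hd hsel h ht
  set i : ℕ → Ω → Fin m := fun t ω => sel fun l => g l (w t ω) with hi
  have him : ∀ t < T, ∀ j, MeasurableSet[ℱ t] {ω | i t ω = j} := fun t ht j =>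
    measurableSet_sel_eq hd hsel (hwm t ht.le) (hwW t) j
  have hdesc := measureReal_descent_le hd hT0 (b := 2 * (A * D)) (L := Real.log (1 / δ)) hη0
    (by linarith) (by positivity) (by
      have : (Gf + γ * Gg) * D ≤ A * D := by
        refine mul_le_mul_of_nonneg_right ?_ hD0.le
        linarith
      linarith)
    -- The index is a function of the current iterate, so its conditional law is the point mass at
    -- `i t`.
    (i := i) (p := fun t ω j => Set.indicator {ω | i t ω = j} (fun _ => (1 : ℝ)) ω)
    (fun t ht => hwm t ht.le) hwW h.subgradients
    (fun t ht j => ℱ.mono (Nat.le_succ t) _ (him t ht j))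
    (fun t ht j => by
      rw [condExp_of_stronglyMeasurable (ℱ.le t)
        (stronglyMeasurable_const.indicator (him t ht j))
        ((integrable_const _).indicator (ℱ.le t _ (him t ht j)))])
    (fun t ω j => Set.indicator_nonneg (fun _ _ => zero_le_one) ω)
    (fun t ω => fullIter_succ_val _ _ _ _) hu
  rw [Real.exp_neg, Real.exp_log (by positivity), one_div, inv_inv] at hdesc
  refine le_trans (measureReal_mono ?_ (measure_ne_top _ _)) hdesc
  intro ω hω hgood
  refine hω fun j => ?_
  have hfin := full_error_le (L := Real.log (1 / δ)) (Real.one_le_sqrt.2 l1)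
    (Real.one_le_sqrt.2 l2) hs0 hD hA0 hG (by linarith) hη
    (by rw [Real.sq_sqrt (by linarith)]; linarith)
  rw [hs2, one_div] at hfin
  have hle : ∑ t ∈ Finset.range T, (f (w t ω) + γ * max 0 (g j (w t ω)) - f u) ≤
      ∑ t ∈ Finset.range T, (f (w t ω) + γ * ∑ l,
        Set.indicator {ω | i t ω = l} (fun _ => (1 : ℝ)) ω * max 0 (g l (w t ω)) - f u) := by
    refine Finset.sum_le_sum fun t _ => ?_
    have h1 : ∑ l, Set.indicator {ω | i t ω = l} (fun _ => (1 : ℝ)) ω * max 0 (g l (w t ω)) =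
        max 0 (g (i t ω) (w t ω)) := by
      rw [Finset.sum_eq_single (i t ω)]
      · simp
      · intro l _ hl
        simp [Set.indicator_of_notMem, Ne.symm hl]
      · simp
    rw [h1]
    have h2 : g j (w t ω) ≤ g (i t ω) (w t ω) := hmax (fun l => g l (w t ω)) j
    gcongr
  refine hle.trans (hgood.trans (hfin.trans ?_))
  rw [one_div] at herr
  calc _ ≤ ε * Real.sqrt T * Real.sqrt T := by gcongr
    _ = ε * T := by rw [mul_assoc, ← sq, hs2]

/-! ### Counting constraint checks -/

/-- With `X` the quantity under the ceiling in `k`, `k ≤ X + 1` gives `m + T (1 + k) ≤ m + 2 T + T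
X`; the initialization and `T X` are charged to the second term, `2 T` to the first. -/
lemma light_checks_le {c A ε δ : ℝ} (hc : 1 ≤ c) (hD : 1 ≤ D) (hA : 0 < A)
    (hε : 0 < ε) (hδ : 0 < δ) (hδ1 : δ < 1) (hεDA : ε ≤ D * A) (hT : T = iterations c m D A δ ε)
    (hk : k = minibatchSize m δ T) :
    ((m + T * (1 + k) : ℕ) : ℝ) ≤ 4 * (c + 1) * checksBound m D A δ ε T := by
  obtain ⟨M, N, hMN, hM, hTM, hmN, hX⟩ :=
    checks_estimates (NeZero.pos m) (by linarith) hD hA hε hδ hδ1 hεDA hT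
  have l1 := one_le_one_add_log_natCast m
  have l2 := one_le_one_add_log_inv hδ hδ1
  have hN : 0 ≤ N := (Nat.cast_nonneg m).trans hmN
  have hkle := (Nat.ceil_lt_add_one (a := (m : ℝ) * (1 + Real.log m) ^ (3 / 4 : ℝ) *
    Real.sqrt (1 + Real.log (1 / δ)) * Real.sqrt (1 + Real.log T) / (T : ℝ) ^ (1 / 4 : ℝ))
    (by positivity)).le
  rw [show ⌈_⌉₊ = k from hk.symm] at hkle
  have h1 := mul_le_mul_of_nonneg_left hkle (Nat.cast_nonneg (α := ℝ) T)
  rw [← hMN]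
  push_cast
  nlinarith [mul_nonneg (by linarith : 0 ≤ c) hM, mul_nonneg (by linarith : 0 ≤ c) hN]

/-- `m < ⌈X⌉` already gives `m < X`, so `T m ≤ T X` is within the second term. -/
lemma full_checks_le {c A ε δ : ℝ} (hc : 1 ≤ c) (hD : 1 ≤ D) (hA : 0 < A)
    (hε : 0 < ε) (hδ : 0 < δ) (hδ1 : δ < 1) (hεDA : ε ≤ D * A) (hT : T = iterations c m D A δ ε)
    (hk : m < minibatchSize m δ T) :
    ((T * (m + 1) : ℕ) : ℝ) ≤ 4 * (c + 1) * checksBound m D A δ ε T := by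
  obtain ⟨M, N, hMN, hM, hTM, hmN, hX⟩ :=
    checks_estimates (NeZero.pos m) (by linarith) hD hA hε hδ hδ1 hεDA hT
  have hN : 0 ≤ N := (Nat.cast_nonneg m).trans hmN
  have h1 := mul_le_mul_of_nonneg_left (Nat.lt_ceil.1 hk).le (Nat.cast_nonneg (α := ℝ) T)
  rw [← hMN]
  push_cast
  nlinarith [mul_nonneg (by linarith : 0 ≤ c) hM, mul_nonneg (by linarith : 0 ≤ c) hN]

end Conclusion

end LightTouch

theorem mainTheorem1 :
    -- universal constants
    ∃ c > (0 : ℝ), ∃ K > (0 : ℝ),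
    ∀ (d m : ℕ) [NeZero m]
      -- the convex problem
      (W : Set (E d)) (f : E d → ℝ) (g : Fin m → E d → ℝ),
      Convex ℝ W → IsClosed W → ConvexOn ℝ W f → (∀ i, ConvexOn ℝ W (g i)) →
    ∀ (Lf Lg : ℝ≥0), LipschitzOnWith Lf f W → (∀ i, LipschitzOnWith Lg (g i) W) →
    -- subgradients of the combined constraint are bounded away from zero on its boundary
    ∀ (ρ : ℝ), 0 < ρ →
      (∀ w ∈ W, maxConstraint g w = 0 →
        ∀ v ∈ subdifferential W (maxConstraint g) w, ρ ≤ ‖v‖) →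
    ∀ (γ : ℝ), (Lf : ℝ) / ρ < γ →
    -- diameter
    ∀ (D : ℝ), 1 ≤ D → (∀ w ∈ W, ∀ w' ∈ W, ‖w - w'‖ ≤ D) →
    -- subgradient oracle for the constraints
    ∀ (Gf Gg : ℝ) (dg : Fin m → E d → E d), (∀ i, Measurable (dg i)) →
      (∀ i, ∀ w ∈ W, dg i w ∈ subdifferential W (fun x => max 0 (g i x)) w) →
      (∀ i, ∀ w ∈ W, ‖dg i w‖ ≤ Gg) →
      0 ≤ Gf → 0 ≤ Gg → 0 < Gf + γ * Gg →
    -- reference point, accuracy, confidence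
    ∀ wstar ∈ feasible W g,
    ∀ (ε δ : ℝ), 0 < ε → 0 < δ → δ < 1 →
    ∀ (A : ℝ), A = Gf + γ * Gg + γ * Lg * D →
    ∀ (T k : ℕ), T = iterations c m D A δ ε → k = minibatchSize m δ T →
    ∀ {Ω : Type*} {mΩ : MeasurableSpace Ω} (P : Measure Ω) [IsProbabilityMeasure P]
      (ℱ : Filtration ℕ mΩ),
      -- if `k ≤ m`: LightTouch
      (k ≤ m →
        ∀ (η : ℝ), η = Real.sqrt (1 + Real.log m) * D / (A * Real.sqrt T) →
        ∀ (w₁ : Ω → E d) (ξ : ℕ → Ω → E d) (i : ℕ → Ω → Fin m) (S : ℕ → Ω → Finset (Fin m)),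
          LightExecution P ℱ W f g dg Gf γ η k T w₁ ξ i S →
          ∀ (out : Ω → Counted (E d)),
            (∀ ω, out ω = lightTouch W g dg γ η k T (w₁ ω) (fun t => ξ t ω) (fun t => i t ω)
              (fun t => S t ω)) →
            1 - δ ≤ P.real {ω | Guarantee W f g γ ρ Lf ε wstar (out ω).val} ∧
            (ε ≤ D * A → ∀ ω, ((out ω).checks : ℝ) ≤ K * checksBound m D A δ ε T)) ∧
      -- if `k > m`: FullTouch
      (m < k →
        ∀ (η : ℝ), η = D / ((Gf + γ * Gg) * Real.sqrt T) →
        ∀ (sel : (Fin m → ℝ) → Fin m), Measurable sel → (∀ (v : Fin m → ℝ) (j : Fin m), v j ≤ v (sel v)) →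
        ∀ (w₁ : Ω → E d) (ξ : ℕ → Ω → E d),
          FullExecution P ℱ W f g dg sel Gf γ η T w₁ ξ →
          ∀ (out : Ω → Counted (E d)),
            (∀ ω, out ω = fullTouch W g dg sel γ η T (w₁ ω) (fun t => ξ t ω)) →
            1 - δ ≤ P.real {ω | Guarantee W f g γ ρ Lf ε wstar (out ω).val} ∧
            (ε ≤ D * A → ∀ ω, ((out ω).checks : ℝ) ≤ K * checksBound m D A δ ε T)) := by

  -- `c` is the square of the constant 100 in the error bounds, and `K = 4 (c + 1)` comes from the
  -- counting lemmas.
  refine ⟨100 ^ 2, by norm_num, 4 * (100 ^ 2 + 1), by norm_num, ?_⟩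
  intro d m _ W f g hW hWc hf hg Lf Lg hfL hgL ρ hρ0 hρ γ hγ D hD hdiam Gf Gg dg hdgm hdgs hdgn
    hGf hGg hG wstar hstar ε δ hε hδ hδ1 A hA T k hT hk Ω mΩ P _ ℱ
  have hγ0 : 0 < γ := lt_of_le_of_lt (by positivity) hγ
  have hd : ConvexData W g dg Lg D Gf Gg γ :=
    ⟨hW, hWc, hgL, hdiam, hdgm, hdgs, hdgn, hγ0, hGf, hGg, hD⟩
  have hgc : ∀ i, ContinuousOn (g i) W := fun i => (hgL i).continuousOn
  -- The high-probability bounds are taken at a minimizer `u` in place of `wstar`, since the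
  -- distance estimate needs the optimal value.
  obtain ⟨u, hu, hopt⟩ := exists_optimal hWc hdiam hfL.continuousOn hgc ⟨_, hstar⟩
  have hβ : 0 ≤ γ * Lg * D := by positivity
  have hA0 : 0 < A := by linarith
  have hT0 : 0 < T := hT ▸ iterations_pos (by norm_num) (by linarith) hA0 hε hδ hδ1
  have key : ∀ w : ℕ → E d, (∀ t, w t ∈ W) →
      (∀ j, ∑ t ∈ Finset.range T, (f (w t) + γ * max 0 (g j (w t)) - f u) ≤ ε * T) →
      Guarantee W f g γ ρ Lf ε wstar ((T : ℝ)⁻¹ • ∑ t ∈ Finset.range T, w t) :=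
    fun w hw h => guarantee_of_penalized_le hWc hg hfL hgc hρ0 hρ hγ
      (average_mem hW hT0 hw) hstar hopt (penalized_average_sub_le hγ0.le hf hg hT0 hw h)
  refine ⟨fun hkm η hη w₁ ξ i S hex out hout => ⟨?_, fun hεDA ω => ?_⟩,
    fun hkm η hη sel hsel hmax w₁ ξ hex out hout => ⟨?_, fun hεDA ω => ?_⟩⟩
  · refine one_sub_le_measureReal (fun ω hω => ?_)
      (measureReal_light_le hd hA hG hε hδ hδ1 hT hk hkm hη hex hu)
    rw [Set.mem_ofPred_eq, hout ω]
    exact key _ (fun t => lightState_w_mem hWc hex.init_mem t ω) (not_not.1 hω)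
  · rw [hout ω]
    refine le_trans (le_of_eq ?_) (light_checks_le (by norm_num) hD hA0 hε hδ hδ1 hεDA hT hk)
    exact congrArg Nat.cast
      (lightState_checks T T le_rfl ω fun s hs => hex.batch_card s hs ω)
  · refine one_sub_le_measureReal (fun ω hω => ?_)
      (measureReal_full_le hd hA hG hε hδ hδ1 hT hη hsel hmax hex hu)
    rw [Set.mem_ofPred_eq, hout ω]
    exact key _ (fun t => fullIter_mem hWc sel (hex.init_mem ω) _ t) (not_not.1 hω)
  · rw [hout ω]
    refine le_trans (le_of_eq ?_)
      (full_checks_le (by norm_num) hD hA0 hε hδ hδ1 hεDA hT (hk ▸ hkm))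
    exact congrArg Nat.cast (fullIter_checks _ _ _ _)
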